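/- Let $\mathbb H$ be the upper half plane with coordinate $\tau$, $y=\operatorname{Im}\tau$, let $T=\begin{pmatrix}1&1\\0&1\end{pmatrix}$ and $\Gamma_\infty=\{\pm T^n : n\in\mathbb Z\}\subset \mathrm{SL}_2(\mathbb Z)$. Let $k,m,j$ be integers with $0\le j\le m$ and $k\equiv m \pmod 2$, and put $\kappa=k-m+2j$. Let $\mathbb C[X]_m$ be the space of polynomials of degree at most $m$. For $\gamma=\begin{pmatrix}a&b\\c&d\end{pmatrix}\in\mathrm{SL}_2(\mathbb Z)$, $f:\mathbb H\to\mathbb C[X]_m$ and $h:\mathbb H\to\mathbb C$ write $$(f|_{k,m}\gamma)(\tau)(X)=(cX+d)^m(c\tau+d)^{-k}f(\gamma\tau)(\gamma X),\qquad (h|_\kappa\gamma)(\tau)=(c\tau+d)^{-\kappa}h(\gamma\tau),$$ where $\gamma X=(aX+b)/(cX+d)$. Set $$\mathfrak e_{j,m-j}(\tau)=\frac{(-1)^{m-j}}{j!}\,y^{j-m}(X-\tau)^j(X-\overline\tau)^{m-j}\in\mathbb C[X]_m .$$ (1) Let $s\in\mathbb C$ with $2\operatorname{Re}(s)+k>2+m$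 and let $\tau\in\mathbb H$. Then the series $$E^{\mathrm{ahol}}_{k,m}(\tau,j,s)=\sum_{\gamma\in\Gamma_\infty\backslash\mathrm{SL}_2(\mathbb Z)}\big(\mathfrak e_{j,m-j}\,y^s\big|_{k,m}\gamma\big)(\tau),\qquad E_\kappa(\tau,s)=\sum_{\gamma\in\Gamma_\infty\backslash\mathrm{SL}_2(\mathbb Z)}\big(y^s\big|_\kappa\gamma\big)(\tau)$$ converge absolutely, and $$E^{\mathrm{ahol}}_{k,m}(\tau,j,s)=\mathfrak e_{j,m-j}(\tau)\cdot E_{k-m+2j}(\tau,s).$$ (2) For every $\tau\in\mathbb H$ the function $s\mapsto E^{\mathrm{ahol}}_{k,m}(\tau,j,s)$ has a meromorphic continuation to all $s\in\mathbb C$ with values in $\mathbb C[X]_m$. It has at most a simple pole at every $s_0\in\mathbb C$ for which $2s_0+\kappa$ is not a multiple zero of the Riemann zeta function; if $2s_0+\kappa$ is a zero of $\zeta$ of multiplicity $\mu\ge2$, then a pole at $s_0$ has order at most $\mu$. (In particular, if all zeros of $\zeta$ are simple, then all poles are at most simple.) -/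

import Mathlib

open UpperHalfPlane ModularForm MatrixGroups Polynomial

noncomputable section

namespace VecEis

/-- The subgroup `Γ_∞ = {± T ^ n : n ∈ ℤ}` of `SL(2, ℤ)`. -/
def GammaInf : Subgroup SL(2, ℤ) where
  carrier := {γ | ∃ n : ℤ, γ = ModularGroup.T ^ n ∨ γ = -(ModularGroup.T ^ n)}
  one_mem' := ⟨0, Or.inl (by simp)⟩
  mul_mem' := by
    rintro _ _ ⟨a, rfl | rfl⟩ ⟨b, rfl | rfl⟩
    · exact ⟨a + b, Or.inl (by rw [zpow_add])⟩
    · exact ⟨a + b, Or.inr (by rw [zpow_add, mul_neg])⟩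
    · exact ⟨a + b, Or.inr (by rw [zpow_add, neg_mul])⟩
    · exact ⟨a + b, Or.inl (by rw [zpow_add, neg_mul_neg])⟩
  inv_mem' := by
    rintro _ ⟨a, rfl | rfl⟩
    · exact ⟨-a, Or.inl (by rw [zpow_neg])⟩
    · exact ⟨-a, Or.inr (by rw [zpow_neg, inv_eq_iff_mul_eq_one, neg_mul_neg, mul_inv_cancel])⟩

/-- The set `Γ_∞ \ SL(2, ℤ)` of cosets `Γ_∞ γ`. -/
abbrev Cosets : Type := Quotient (QuotientGroup.rightRel GammaInf)

/-- The function `τ ↦ y ^ s` on the upper half plane, where `y = Im τ`. -/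
def imPow (s : ℂ) (τ : ℍ) : ℂ := (τ.im : ℂ) ^ s

/-- The term `(y ^ s |_k γ)(τ)` of the scalar Eisenstein series at the coset `Γ_∞ γ`; for even `k`
it does not depend on the representative. -/
def eisTerm (k : ℤ) (s : ℂ) (τ : ℍ) (q : Cosets) : ℂ := (imPow s ∣[k] q.out) τ

/-- The real-analytic Eisenstein series `E_k(τ, s)`. -/
def eis (k : ℤ) (τ : ℍ) (s : ℂ) : ℂ := ∑' q : Cosets, eisTerm k s τ q

/-- The action `p ↦ (c X + d) ^ m * p ((a X + b) / (c X + d))` of `γ = (a, b; c, d)` on polynomials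
of degree at most `m`, with denominators cleared (see `symAct_eval`). -/
def symAct (m : ℕ) (γ : SL(2, ℤ)) (p : ℂ[X]) : ℂ[X] :=
  ∑ i ∈ Finset.range (m + 1), C (p.coeff i) *
    (C (γ 0 0 : ℂ) * X + C (γ 0 1 : ℂ)) ^ i * (C (γ 1 0 : ℂ) * X + C (γ 1 1 : ℂ)) ^ (m - i)

theorem symAct_eval (m : ℕ) (γ : SL(2, ℤ)) (p : ℂ[X]) (hp : p.natDegree ≤ m) (x : ℂ)
    (hx : (γ 1 0 : ℂ) * x + γ 1 1 ≠ 0) :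
    (symAct m γ p).eval x = ((γ 1 0 : ℂ) * x + γ 1 1) ^ m *
      p.eval (((γ 0 0 : ℂ) * x + γ 0 1) / ((γ 1 0 : ℂ) * x + γ 1 1)) := by
  rw [Polynomial.eval_eq_sum_range' (Nat.lt_succ_of_le hp), symAct, Polynomial.eval_finsetSum,
    Finset.mul_sum]
  refine Finset.sum_congr rfl fun i hi => ?_
  have hi' : i ≤ m := Nat.lt_succ_iff.mp (Finset.mem_range.mp hi)
  simp only [eval_mul, eval_pow, eval_add, eval_C, eval_X]
  set d : ℂ := (γ 1 0 : ℂ) * x + γ 1 1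
  have hd : d ^ m = d ^ (m - i) * d ^ i := by rw [← pow_add, Nat.sub_add_cancel hi']
  rw [hd, div_pow]
  field_simp

/-- The slash action `f |_{k,m} γ` on functions with values in polynomials of degree at most `m`:
`(f |_{k,m} γ)(τ)(X) = (c X + d) ^ m * (c τ + d) ^ (-k) * f (γ τ) (γ X)`. -/
def vecSlash (k : ℤ) (m : ℕ) (f : ℍ → ℂ[X]) (γ : SL(2, ℤ)) (τ : ℍ) : ℂ[X] :=
  C (denom γ τ ^ (-k)) * symAct m γ (f (γ • τ))

/-- The function `𝔢_{j,m-j}(τ) = (-1)^(m-j) / j! * y^(j-m) * (X - τ)^j * (X - conj τ)^(m-j)`,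
for `j ≤ m`. -/
def basisE (m j : ℕ) (τ : ℍ) : ℂ[X] :=
  C ((-1) ^ (m - j) / (j.factorial : ℂ) * (τ.im : ℂ) ^ ((j : ℤ) - (m : ℤ))) *
    (X - C (τ : ℂ)) ^ j * (X - C (starRingEnd ℂ (τ : ℂ))) ^ (m - j)

/-- The term `((𝔢_{j,m-j} y ^ s) |_{k,m} γ)(τ)` of the vector-valued Eisenstein series at the coset
`Γ_∞ γ`; for `k ≡ m` modulo 2 it does not depend on the representative
(see `eisAholTerm_mk`). -/
def eisAholTerm (k : ℤ) (m j : ℕ) (s : ℂ) (τ : ℍ) (q : Cosets) : ℂ[X] :=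
  vecSlash k m (fun z => C (imPow s z) * basisE m j z) q.out τ

theorem natDegree_imPow_mul_basisE (m j : ℕ) (hj : j ≤ m) (s : ℂ) (τ : ℍ) :
    (C (imPow s τ) * basisE m j τ).natDegree ≤ m := by
  unfold basisE
  refine (natDegree_C_mul_le _ _).trans (natDegree_mul_le.trans ?_)
  have h1 := natDegree_C_mul_le ((-1) ^ (m - j) / (j.factorial : ℂ) *
    (τ.im : ℂ) ^ ((j : ℤ) - (m : ℤ))) ((X - C (τ : ℂ)) ^ j)
  rw [natDegree_pow, natDegree_X_sub_C] at h1
  rw [natDegree_pow, natDegree_X_sub_C]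
  omega

theorem vecSlash_neg (k : ℤ) (m : ℕ) (hkm : k ≡ (m : ℤ) [ZMOD 2]) (f : ℍ → ℂ[X]) (γ : SL(2, ℤ))
    (τ : ℍ) : vecSlash k m f (-γ) τ = vecSlash k m f γ τ := by
  have hs : symAct m (-γ) (f (γ • τ)) = C ((-1) ^ m) * symAct m γ (f (γ • τ)) := by
    rw [symAct, symAct, Finset.mul_sum]
    refine Finset.sum_congr rfl fun i hi => ?_
    have hi' : i ≤ m := Nat.lt_succ_iff.mp (Finset.mem_range.mp hi)
    have e : (C ((-1 : ℂ) ^ m) : ℂ[X]) = (-1) ^ i * (-1) ^ (m - i) := by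
      rw [← pow_add, Nat.add_sub_cancel' hi']; simp
    have e1 : (C (((-γ) 0 0 : ℤ) : ℂ) * X + C (((-γ) 0 1 : ℤ) : ℂ) : ℂ[X]) =
        (-1) * (C (γ 0 0 : ℂ) * X + C (γ 0 1 : ℂ)) := by
      simp; ring
    have e2 : (C (((-γ) 1 0 : ℤ) : ℂ) * X + C (((-γ) 1 1 : ℤ) : ℂ) : ℂ[X]) =
        (-1) * (C (γ 1 0 : ℂ) * X + C (γ 1 1 : ℂ)) := by
      simp; ring
    rw [e, e1, e2, mul_pow, mul_pow]
    ring
  have hd : denom ((-γ : SL(2, ℤ)) : GL (Fin 2) ℝ) τ = (-1) * denom (γ : GL (Fin 2) ℝ) τ := by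
    rw [ModularGroup.denom_apply, ModularGroup.denom_apply]
    simp; ring
  have hsign : ((-1 : ℂ) ^ (-k)) * (-1) ^ m = 1 := by
    rw [← zpow_natCast, ← zpow_add₀ (by norm_num)]
    refine Even.neg_one_zpow ?_
    obtain ⟨c, hc⟩ := hkm.dvd
    exact ⟨c, by omega⟩
  rw [vecSlash, vecSlash, ModularGroup.SL_neg_smul, hs, hd, mul_zpow, ← mul_assoc, ← C_mul]
  congr 2
  linear_combination denom (γ : GL (Fin 2) ℝ) τ ^ (-k) * hsign

theorem vecSlash_basisE_T (k : ℤ) (m j : ℕ) (hj : j ≤ m) (s : ℂ) (τ : ℍ) (n : ℤ)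
    (γ : SL(2, ℤ)) : vecSlash k m (fun z => C (imPow s z) * basisE m j z)
      (ModularGroup.T ^ n * γ) τ = vecSlash k m (fun z => C (imPow s z) * basisE m j z) γ τ := by
  have h00 : (ModularGroup.T ^ n * γ) 0 0 = γ 0 0 + n * γ 1 0 := by
    simp [Matrix.SpecialLinearGroup.coe_mul, ModularGroup.coe_T_zpow, Matrix.mul_apply]
  have h01 : (ModularGroup.T ^ n * γ) 0 1 = γ 0 1 + n * γ 1 1 := by
    simp [Matrix.SpecialLinearGroup.coe_mul, ModularGroup.coe_T_zpow, Matrix.mul_apply]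
  have h10 : (ModularGroup.T ^ n * γ) 1 0 = γ 1 0 := by
    simp
  have h11 : (ModularGroup.T ^ n * γ) 1 1 = γ 1 1 := by
    simp
  rw [vecSlash, vecSlash, ModularGroup.denom_apply, ModularGroup.denom_apply, h10, h11]
  refine congrArg (fun p => C (((γ 1 0 : ℂ) * τ + γ 1 1) ^ (-k)) * p) ?_
  have hne : (C (γ 1 0 : ℂ) * X + C (γ 1 1 : ℂ) : ℂ[X]) ≠ 0 := by
    intro h
    have hτ := congrArg (Polynomial.eval (τ : ℂ)) h
    simp only [eval_add, eval_mul, eval_C, eval_X, eval_zero] at hτ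
    exact denom_ne_zero (γ : GL (Fin 2) ℝ) τ (by rw [ModularGroup.denom_apply]; simpa using hτ)
  refine Polynomial.eq_of_infinite_eval_eq _ _ (Set.Infinite.mono (s :=
    {x | IsRoot (C (γ 1 0 : ℂ) * X + C (γ 1 1 : ℂ) : ℂ[X]) x}ᶜ) ?_
    (Polynomial.finite_setOfPred_isRoot hne).infinite_compl)
  intro x hx
  have hx' : (γ 1 0 : ℂ) * x + γ 1 1 ≠ 0 := by simpa [IsRoot] using hx
  rw [Set.mem_ofPred_eq, symAct_eval _ _ _ (natDegree_imPow_mul_basisE m j hj s _) _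
    (by rwa [h10, h11]), symAct_eval _ _ _ (natDegree_imPow_mul_basisE m j hj s _) _ hx',
    h00, h01, h10, h11, mul_smul]
  have hz : ((ModularGroup.T ^ n • γ • τ : ℍ) : ℂ) = (γ • τ : ℍ) + (n : ℂ) := by
    rw [modular_T_zpow_smul, coe_vadd]
    push_cast
    ring
  have him : (ModularGroup.T ^ n • γ • τ : ℍ).im = (γ • τ : ℍ).im :=
    ModularGroup.im_T_zpow_smul _ n
  have hq : (((γ 0 0 + n * γ 1 0 : ℤ) : ℂ) * x + ((γ 0 1 + n * γ 1 1 : ℤ) : ℂ)) /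
      ((γ 1 0 : ℂ) * x + γ 1 1) =
      ((γ 0 0 : ℂ) * x + γ 0 1) / ((γ 1 0 : ℂ) * x + γ 1 1) + n := by
    push_cast
    field_simp
    ring
  rw [hq, imPow, imPow, basisE, basisE, him, hz]
  simp only [eval_mul, eval_pow, eval_sub, eval_C, eval_X, eval_add, eval_intCast, map_add, map_intCast,
    add_sub_add_right_eq_sub]

/-- For `k ≡ m` modulo 2 the function `(𝔢_{j,m-j} y ^ s) |_{k,m} γ` depends on `Γ_∞ γ` only. -/
theorem vecSlash_basisE_mul_left (k : ℤ) (m j : ℕ) (hj : j ≤ m) (hkm : k ≡ (m : ℤ) [ZMOD 2])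
    (s : ℂ) (τ : ℍ) (δ γ : SL(2, ℤ)) (hδ : δ ∈ GammaInf) :
    vecSlash k m (fun z => C (imPow s z) * basisE m j z) (δ * γ) τ =
      vecSlash k m (fun z => C (imPow s z) * basisE m j z) γ τ := by
  obtain ⟨n, rfl | rfl⟩ := hδ
  · exact vecSlash_basisE_T k m j hj s τ n γ
  · rw [neg_mul, vecSlash_neg k m hkm]
    exact vecSlash_basisE_T k m j hj s τ n γ

/-- The term at the coset `Γ_∞ γ` is given by the representative `γ`. -/
theorem eisAholTerm_mk (k : ℤ) (m j : ℕ) (hj : j ≤ m) (hkm : k ≡ (m : ℤ) [ZMOD 2])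
    (s : ℂ) (τ : ℍ) (γ : SL(2, ℤ)) :
    eisAholTerm k m j s τ (Quotient.mk _ γ) =
      vecSlash k m (fun z => C (imPow s z) * basisE m j z) γ τ := by
  have h : (QuotientGroup.rightRel GammaInf) (Quotient.mk _ γ : Cosets).out γ :=
    Quotient.mk_out γ
  rw [QuotientGroup.rightRel_apply] at h
  rw [eisAholTerm, ← vecSlash_basisE_mul_left k m j hj hkm s τ _ _ h, inv_mul_cancel_right]

/-- The vector-valued Eisenstein series `E^ahol_{k,m}(τ, j, s)`, a polynomial in `X` of degree at
most `m`, summed coefficient by coefficient. -/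
def eisAhol (k : ℤ) (m j : ℕ) (τ : ℍ) (s : ℂ) : ℂ[X] :=
  ∑ n ∈ Finset.range (m + 1), monomial n (∑' q : Cosets, (eisAholTerm k m j s τ q).coeff n)

end VecEis

end

noncomputable section

namespace VecEis

/-! The polynomials `basisE` are equivariant: slashing 𝔢·y^s by γ multiplies 𝔢 by the scalar y^s |_κ
γ (`vecSlash_basisE`). The vector-valued series is thus 𝔢 times E_κ term by term, and all analysis
concerns E_κ, where κ is even because k ≡ m mod 2.

Every nonzero (c, d) is uniquely a nonzero multiple of a chosen bottom row, so 2ζ(2s+κ)·E_κ is a sum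
over the whole lattice (`tsum_latSummand`). With Q = |cτ+d|²/y, that sum is a Dirichlet series ∑
(cτ+d)^N / Q^w with N = |κ|, directly for κ ≤ 0 and after complex conjugation for κ ≥ 0.

This Dirichlet series is a Mellin transform of the theta series `harmTheta`. Its functional equation
t ↔ 1/t comes from the generating function ∑ exp(u(cτ+d) - πQt): two one-variable Poisson summations
transform it (`tsum_thetaTerm`), and comparing coefficients of u^N gives the equation for each even
N (`harmTheta_one_div`). Mathlib's `WeakFEPair` then continues the lattice sum, with at most one
pole, simple, at w = 1 and only for N = 0.

Dividing by ζ(2s+κ) introduces poles only at zeros of ζ, of order at most their multiplicity. For κ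
= 0 the lattice pole s = 1 meets ζ(2) ≠ 0, so the two sources never add up. -/

theorem natDegree_basisE (m j : ℕ) (hj : j ≤ m) (τ : ℍ) : (basisE m j τ).natDegree ≤ m := by
  simpa [imPow] using natDegree_imPow_mul_basisE m j hj 0 τ

/-! ### Equivariance of 𝔢 and reduction to the scalar series -/

/-- The lattice element `c τ + d` attached to a pair of integers `(c, d)`. -/
def lat (τ : ℍ) (v : ℤ × ℤ) : ℂ := v.1 * (τ : ℂ) + v.2

/-- The summand `(c τ + d) ^ (-κ) * (y / |c τ + d| ^ 2) ^ s` of a non-holomorphic lattice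
Eisenstein series. -/
def latSummand (κ : ℤ) (s : ℂ) (τ : ℍ) (v : ℤ × ℤ) : ℂ :=
  lat τ v ^ (-κ) * ((τ.im / ‖lat τ v‖ ^ 2 : ℝ) : ℂ) ^ s

/-- The bottom row of a matrix in `SL(2, ℤ)`. -/
def bottomRow (γ : SL(2, ℤ)) : ℤ × ℤ := (γ 1 0, γ 1 1)

theorem lat_bottomRow (γ : SL(2, ℤ)) (τ : ℍ) :
    lat τ (bottomRow γ) = denom (γ : GL (Fin 2) ℝ) τ := by
  rw [ModularGroup.denom_apply]; rfl

theorem slash_imPow (κ : ℤ) (s : ℂ) (τ : ℍ) (γ : SL(2, ℤ)) :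
    (imPow s ∣[κ] γ) τ = latSummand κ s τ (bottomRow γ) := by
  rw [SL_slash_apply, latSummand, lat_bottomRow, imPow, ModularGroup.im_smul_eq_div_normSq,
    Complex.normSq_eq_norm_sq, mul_comm]

/-- With D = cτ+d, γX - γτ = (X-τ)/((cX+d)D), and likewise with τ and D conjugated. The powers of
cX+d cancel against (cX+d)^m, and Im γτ = y/(D·conj D) cancels every conj D outside the y^s factor,
leaving D^(-k+m-2j) = D^(-κ). -/
theorem vecSlash_basisE (k : ℤ) (m j : ℕ) (hj : j ≤ m) (s : ℂ) (τ : ℍ) (γ : SL(2, ℤ)) :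
    vecSlash k m (fun z => C (imPow s z) * basisE m j z) γ τ =
      basisE m j τ * C ((imPow s ∣[k - m + 2 * j] γ) τ) := by
  set D : ℂ := denom (γ : GL (Fin 2) ℝ) τ with hD
  have hD' : (γ 1 0 : ℂ) * τ + γ 1 1 = D := by rw [hD, ModularGroup.denom_apply]
  have hD0 : D ≠ 0 := denom_ne_zero _ _
  have hne : (C (γ 1 0 : ℂ) * X + C (γ 1 1 : ℂ) : ℂ[X]) ≠ 0 := by
    intro h
    have hτ := congrArg (Polynomial.eval (τ : ℂ)) h
    simp only [eval_add, eval_mul, eval_C, eval_X, eval_zero] at hτ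
    exact hD0 (hD' ▸ hτ)
  -- Compare values off the root of cX+d, where γX makes sense; infinitely many points remain.
  refine Polynomial.eq_of_infinite_eval_eq _ _ (Set.Infinite.mono (s :=
    {x | IsRoot (C (γ 1 0 : ℂ) * X + C (γ 1 1 : ℂ) : ℂ[X]) x}ᶜ) ?_
    (Polynomial.finite_setOfPred_isRoot hne).infinite_compl)
  intro x hx
  have hx' : (γ 1 0 : ℂ) * x + γ 1 1 ≠ 0 := by simpa [IsRoot] using hx
  have hdet : (γ 0 0 : ℂ) * γ 1 1 - γ 0 1 * γ 1 0 = 1 := by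
    have := γ.det_coe
    rw [Matrix.det_fin_two] at this
    exact_mod_cast this
  have hz : ((γ • τ : ℍ) : ℂ) = ((γ 0 0 : ℂ) * τ + γ 0 1) / D := by
    rw [← hD', UpperHalfPlane.coe_specialLinearGroup_apply]; simp
  have hDc : (γ 1 0 : ℂ) * (starRingEnd ℂ τ) + γ 1 1 = starRingEnd ℂ D := by
    rw [← hD']; simp
  have hDc0 : starRingEnd ℂ D ≠ 0 := by simpa using hD0
  have hzc : starRingEnd ℂ ((γ • τ : ℍ) : ℂ) =
      ((γ 0 0 : ℂ) * starRingEnd ℂ τ + γ 0 1) / starRingEnd ℂ D := by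
    rw [hz]; simp
  have e1 : ((γ 0 0 : ℂ) * x + γ 0 1) / ((γ 1 0 : ℂ) * x + γ 1 1) - (γ • τ : ℍ) =
      (x - τ) / (((γ 1 0 : ℂ) * x + γ 1 1) * D) := by
    rw [hz, div_sub_div _ _ hx' hD0]
    congr 1
    rw [← hD']
    linear_combination (x - τ) * hdet
  have e2 : ((γ 0 0 : ℂ) * x + γ 0 1) / ((γ 1 0 : ℂ) * x + γ 1 1) -
      starRingEnd ℂ ((γ • τ : ℍ) : ℂ) =
      (x - starRingEnd ℂ τ) / (((γ 1 0 : ℂ) * x + γ 1 1) * starRingEnd ℂ D) := by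
    rw [hzc, div_sub_div _ _ hx' hDc0]
    congr 1
    rw [← hDc]
    linear_combination (x - starRingEnd ℂ τ) * hdet
  have him : ((γ • τ : ℍ).im : ℂ) = τ.im / (D * starRingEnd ℂ D) := by
    rw [ModularGroup.im_smul_eq_div_normSq, Complex.mul_conj]
    push_cast; rfl
  have hy : (τ.im : ℂ) ≠ 0 := by exact_mod_cast τ.im_pos.ne'
  rw [Set.mem_ofPred_eq, vecSlash, SL_slash_apply, ← hD, eval_mul, eval_C,
    symAct_eval _ _ _ (natDegree_imPow_mul_basisE m j hj s _) _ hx', basisE, basisE]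
  simp only [eval_mul, eval_pow, eval_sub, eval_C, eval_X]
  rw [e1, e2, him]
  set d : ℂ := (γ 1 0 : ℂ) * x + γ 1 1
  obtain ⟨i, rfl⟩ := Nat.exists_eq_add_of_le hj
  have h1 : (j : ℤ) - ((j + i : ℕ) : ℤ) = -(i : ℤ) := by push_cast; ring
  have h2 : D ^ (-(k - ((j + i : ℕ) : ℤ) + 2 * (j : ℤ))) = D ^ (-k) * D ^ i / D ^ j := by
    rw [← zpow_natCast D i, ← zpow_natCast D j, ← zpow_add₀ hD0, ← zpow_sub₀ hD0]
    congr 1; push_cast; ring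
  rw [h1, h2, Nat.add_sub_cancel_left]
  simp only [zpow_neg, zpow_natCast]
  simp only [div_pow, mul_pow, pow_add]
  field_simp

theorem eisAholTerm_eq (k : ℤ) (m j : ℕ) (hj : j ≤ m) (s : ℂ) (τ : ℍ) (q : Cosets) :
    eisAholTerm k m j s τ q = basisE m j τ * C (eisTerm (k - m + 2 * j) s τ q) :=
  vecSlash_basisE k m j hj s τ q.out

theorem eisAhol_eq (k : ℤ) (m j : ℕ) (hj : j ≤ m) (s : ℂ) (τ : ℍ) :
    eisAhol k m j τ s = basisE m j τ * C (eis (k - m + 2 * j) τ s) := by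
  simp_rw [eisAhol, eisAholTerm_eq k m j hj, coeff_mul_C, tsum_mul_left]
  conv_rhs => rw [(basisE m j τ).as_sum_range' (m + 1)
    (Nat.lt_succ_of_le (natDegree_basisE m j hj τ)), Finset.sum_mul]
  simp_rw [monomial_mul_C]
  rfl

/-! ### Cosets and primitive vectors -/

theorem eisTerm_eq (κ : ℤ) (s : ℂ) (τ : ℍ) (q : Cosets) :
    eisTerm κ s τ q = latSummand κ s τ (bottomRow q.out) :=
  slash_imPow κ s τ q.out

/-- By the determinant condition γδ⁻¹ has bottom row (0, 1) and diagonal entries 1, so it is the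
power of T given by its upper right entry. -/
theorem mem_GammaInf_of_bottomRow_eq {γ δ : SL(2, ℤ)} (h : bottomRow γ = bottomRow δ) :
    γ * δ⁻¹ ∈ GammaInf := by
  obtain ⟨h0, h1⟩ := Prod.mk.inj h
  have hd := δ.det_coe
  have hc := γ.det_coe
  rw [Matrix.det_fin_two] at hd hc
  refine ⟨-(γ 0 0 * δ 0 1) + γ 0 1 * δ 0 0, Or.inl ?_⟩
  ext a b
  rw [ModularGroup.coe_T_zpow]
  fin_cases a <;> fin_cases b <;>
    simp [Matrix.SpecialLinearGroup.coe_mul, Matrix.SpecialLinearGroup.coe_inv,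
      Matrix.adjugate_fin_two, Matrix.mul_apply, Fin.sum_univ_two]
  · rw [← h0, ← h1]; linarith
  · rw [h0, h1]; linarith
  · rw [h0, h1]; linarith

theorem bottomRow_neg (γ : SL(2, ℤ)) : bottomRow (-γ) = -bottomRow γ := by
  simp [bottomRow]

theorem bottomRow_mul_of_mem {δ : SL(2, ℤ)} (hδ : δ ∈ GammaInf) (γ : SL(2, ℤ)) :
    bottomRow (δ * γ) = bottomRow γ ∨ bottomRow (δ * γ) = -bottomRow γ := by
  obtain ⟨n, rfl | rfl⟩ := hδ
  · left; simp [bottomRow]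
  · right; rw [neg_mul, bottomRow_neg]; simp [bottomRow]

theorem rightRel_of_bottomRow {γ δ : SL(2, ℤ)}
    (h : bottomRow γ = bottomRow δ ∨ bottomRow γ = -bottomRow δ) :
    (QuotientGroup.rightRel GammaInf) δ γ := by
  rw [QuotientGroup.rightRel_apply]
  rcases h with h | h
  · exact mem_GammaInf_of_bottomRow_eq h
  · have : γ * (-δ)⁻¹ ∈ GammaInf := mem_GammaInf_of_bottomRow_eq (by rw [h, bottomRow_neg])
    have e : γ * δ⁻¹ = -1 * (γ * (-δ)⁻¹) := by
      have : (-δ)⁻¹ = -δ⁻¹ := by rw [inv_eq_iff_mul_eq_one, neg_mul_neg, mul_inv_cancel]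
      rw [this]; simp
    rw [e]
    exact GammaInf.mul_mem ⟨0, Or.inr (by simp)⟩ this

/-- Every nonzero integer vector is uniquely a nonzero multiple of the bottom row of the chosen
representative of a coset. -/
theorem bijective_smul_bottomRow :
    Function.Bijective fun p : Cosets × {n : ℤ // n ≠ 0} =>
      (⟨(p.2 : ℤ) • bottomRow p.1.out, by
        have hc := ModularGroup.bottom_row_coprime p.1.out
        intro h
        have h0 := congrArg Prod.fst h
        have h1 := congrArg Prod.snd h
        simp [p.2.2, bottomRow] at h0 h1
        rw [h0, h1] at hc
        exact not_isCoprime_zero_zero hc⟩ : {v : ℤ × ℤ // v ≠ 0}) := by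
  constructor
  · rintro ⟨q, n, hn⟩ ⟨q', n', hn'⟩ h
    replace h : n • bottomRow q.out = n' • bottomRow q'.out := congrArg Subtype.val h
    have h0 : n * q.out 1 0 = n' * q'.out 1 0 := congrArg Prod.fst h
    have h1 : n * q.out 1 1 = n' * q'.out 1 1 := congrArg Prod.snd h
    obtain ⟨a, b, hab⟩ := ModularGroup.bottom_row_coprime q.out
    obtain ⟨a', b', hab'⟩ := ModularGroup.bottom_row_coprime q'.out
    -- A Bézout relation for a primitive row writes n as a combination of the entries of n times
    -- that row, all divisible by n'.
    have d1 : n' ∣ n := ⟨a * q'.out 1 0 + b * q'.out 1 1, by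
      linear_combination (-n) * hab + a * h0 + b * h1⟩
    have d2 : n ∣ n' := ⟨a' * q.out 1 0 + b' * q.out 1 1, by
      linear_combination (-n') * hab' - a' * h0 - b' * h1⟩
    have hq : q = q' := by
      rcases Int.natAbs_eq_natAbs_iff.mp (Nat.dvd_antisymm (Int.natAbs_dvd_natAbs.mpr d1)
        (Int.natAbs_dvd_natAbs.mpr d2)) with e | e
      · subst e
        have := smul_right_injective (ℤ × ℤ) hn' h
        rw [← Quotient.out_eq q, ← Quotient.out_eq q']
        exact (Quotient.sound (rightRel_of_bottomRow (Or.inl this))).symm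
      · subst e
        have : bottomRow q.out = -bottomRow q'.out :=
          smul_right_injective (ℤ × ℤ) hn' (by simpa [neg_eq_iff_eq_neg] using h)
        rw [← Quotient.out_eq q, ← Quotient.out_eq q']
        exact (Quotient.sound (rightRel_of_bottomRow (Or.inr this))).symm
    subst hq
    have hn2 : n = n' := by linear_combination (-(n - n')) * hab + a * h0 + b * h1
    subst hn2
    rfl
  · rintro ⟨⟨c, d⟩, hv⟩
    have hg : 0 < Int.gcd c d := by
      refine Int.gcd_pos_iff.mpr ?_
      by_contra! h
      exact hv (by rw [h.1, h.2]; rfl)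
    obtain ⟨c', d', hcop, hc, hd⟩ := Int.exists_gcd_one hg
    obtain ⟨γ, -, hγ⟩ := ModularGroup.bottom_row_surj
      (show ![c', d'] ∈ {cd : Fin 2 → ℤ | IsCoprime (cd 0) (cd 1)} from
        Int.isCoprime_iff_gcd_eq_one.mpr hcop)
    have hγ' : bottomRow γ = (c', d') := by
      have h0 := congrFun hγ 0
      have h1 := congrFun hγ 1
      simp at h0 h1
      exact Prod.ext h0 h1
    have hout : (QuotientGroup.rightRel GammaInf) (Quotient.mk _ γ : Cosets).out γ :=
      Quotient.mk_out γ
    rw [QuotientGroup.rightRel_apply] at hout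
    have hg0 : (Int.gcd c d : ℤ) ≠ 0 := by exact_mod_cast hg.ne'
    -- The chosen representative may carry the opposite sign of the primitive vector; the sign then
    -- moves into the multiplier.
    have := bottomRow_mul_of_mem hout (Quotient.mk _ γ : Cosets).out
    rw [inv_mul_cancel_right, hγ'] at this
    rcases this with h | h
    · refine ⟨(Quotient.mk _ γ, ⟨Int.gcd c d, hg0⟩), Subtype.ext ?_⟩
      change (Int.gcd c d : ℤ) • bottomRow (Quotient.mk _ γ : Cosets).out = (c, d)
      rw [← h, Prod.smul_mk, smul_eq_mul, smul_eq_mul, mul_comm, ← hc, mul_comm, ← hd]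
    · refine ⟨(Quotient.mk _ γ, ⟨-Int.gcd c d, neg_ne_zero.mpr hg0⟩), Subtype.ext ?_⟩
      change (-Int.gcd c d : ℤ) • bottomRow (Quotient.mk _ γ : Cosets).out = (c, d)
      rw [_root_.neg_smul, ← smul_neg, ← h, Prod.smul_mk, smul_eq_mul, smul_eq_mul, mul_comm, ← hc,
        mul_comm, ← hd]

/-! ### Convergence of the lattice sum and the factor ζ(2s+κ) -/

theorem lat_zero (τ : ℍ) : lat τ 0 = 0 := by simp [lat]

theorem lat_zsmul (τ : ℍ) (n : ℤ) (v : ℤ × ℤ) : lat τ (n • v) = n * lat τ v := by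
  simp [lat]; ring

theorem exists_mul_norm_le_norm_lat (τ : ℍ) :
    ∃ r : ℝ, 0 < r ∧ ∀ v : ℤ × ℤ, r * ‖v‖ ≤ ‖lat τ v‖ := by
  refine ⟨EisensteinSeries.r τ, EisensteinSeries.r_pos τ, fun v => ?_⟩
  by_cases hv : v = 0
  · simp [hv, lat_zero]
  have h := EisensteinSeries.r_mul_max_le τ (x := ![v.1, v.2]) (fun h => hv
    (Prod.ext (by simpa using congrFun h 0) (by simpa using congrFun h 1)))
  refine le_trans (le_of_eq ?_) h
  congr 1
  rw [EisensteinSeries.norm_eq_max_natAbs, Prod.norm_def, Int.norm_eq_abs, Int.norm_eq_abs]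
  simp [Nat.cast_natAbs]

theorem lat_ne_zero (τ : ℍ) {v : ℤ × ℤ} (hv : v ≠ 0) : lat τ v ≠ 0 := by
  obtain ⟨r, hr, h⟩ := exists_mul_norm_le_norm_lat τ
  have := mul_pos hr (norm_pos_iff.mpr hv)
  exact norm_pos_iff.mp (this.trans_le (h v))

theorem exists_le_norm_lat (τ : ℍ) :
    ∃ r : ℝ, 0 < r ∧ ∀ v : ℤ × ℤ, v ≠ 0 → r ≤ ‖lat τ v‖ := by
  obtain ⟨r, hr, h⟩ := exists_mul_norm_le_norm_lat τ
  refine ⟨r, hr, fun v hv => le_trans ?_ (h v)⟩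
  refine le_mul_of_one_le_right hr.le ?_
  rw [Prod.norm_def, Int.norm_eq_abs, Int.norm_eq_abs]
  have : v.1 ≠ 0 ∨ v.2 ≠ 0 := by
    by_contra! h
    exact hv (Prod.ext h.1 h.2)
  rcases this with h | h
  · exact le_max_of_le_left (by exact_mod_cast Int.one_le_abs h)
  · exact le_max_of_le_right (by exact_mod_cast Int.one_le_abs h)

theorem summable_norm_lat_rpow (τ : ℍ) {a : ℝ} (ha : 2 < a) :
    Summable fun v : ℤ × ℤ => ‖lat τ v‖ ^ (-a) := by
  have h := (EisensteinSeries.summable_one_div_norm_rpow ha).mul_left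
    (EisensteinSeries.r τ ^ (-a))
  rw [← (finTwoArrowEquiv ℤ).symm.summable_iff] at h
  refine h.of_nonneg_of_le (fun v => by positivity) fun v => ?_
  simpa [lat] using EisensteinSeries.summand_bound τ (by linarith : 0 ≤ a) ![v.1, v.2]

/-- Division by zero gives 0 here, so the summand at the origin is 0^(-κ)·0^s, which fails to vanish
only when both exponents are 0. -/
theorem latSummand_zero (κ : ℤ) (s : ℂ) (τ : ℍ) (h : κ ≠ 0 ∨ s ≠ 0) :
    latSummand κ s τ 0 = 0 := by
  rw [latSummand, lat_zero]
  rcases h with h | h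
  · rw [zero_zpow _ (neg_ne_zero.mpr h), zero_mul]
  · simp [h]

theorem norm_latSummand (κ : ℤ) (s : ℂ) (τ : ℍ) {v : ℤ × ℤ} (hv : v ≠ 0) :
    ‖latSummand κ s τ v‖ = τ.im ^ s.re * ‖lat τ v‖ ^ (-(2 * s.re + κ)) := by
  have hl := norm_pos_iff.mpr (lat_ne_zero τ hv)
  have hy := τ.im_pos
  rw [latSummand, norm_mul, norm_zpow, Complex.norm_cpow_eq_rpow_re_of_pos (by positivity),
    Real.div_rpow hy.le (by positivity), ← Real.rpow_intCast, ← Real.rpow_natCast,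
    ← Real.rpow_mul hl.le, div_eq_mul_inv, ← Real.rpow_neg hl.le, mul_left_comm,
    ← Real.rpow_add hl]
  congr 2
  push_cast; ring

theorem index_ne_zero {κ : ℤ} {s : ℂ} (hs : 2 < 2 * s.re + κ) : κ ≠ 0 ∨ s ≠ 0 := by
  by_contra! h
  rw [h.1, h.2] at hs
  norm_num at hs

theorem summable_latSummand {κ : ℤ} {s : ℂ} (τ : ℍ) (hs : 2 < 2 * s.re + κ) :
    Summable fun v => latSummand κ s τ v := by
  refine Summable.of_norm (((summable_norm_lat_rpow τ hs).mul_left (τ.im ^ s.re)).of_nonneg_of_le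
    (fun v => norm_nonneg _) fun v => ?_)
  by_cases hv : v = 0
  · rw [hv, latSummand_zero κ s τ (index_ne_zero hs), norm_zero]
    have := τ.im_pos
    positivity
  · exact (norm_latSummand κ s τ hv).le

/-- Evenness of κ removes the sign of n: the factor n^(-κ) becomes |n|^(-κ) and combines with
|n|^(-2s). -/
theorem latSummand_zsmul {κ : ℤ} (hκ : Even κ) (s : ℂ) (τ : ℍ) {n : ℤ} (hn : n ≠ 0)
    {v : ℤ × ℤ} (hv : v ≠ 0) :
    latSummand κ s τ (n • v) = ((n.natAbs : ℂ) ^ (2 * s + κ))⁻¹ * latSummand κ s τ v := by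
  have hl := norm_pos_iff.mpr (lat_ne_zero τ hv)
  have hy := τ.im_pos
  have hn' : (0 : ℝ) < n.natAbs := by exact_mod_cast Int.natAbs_pos.mpr hn
  have hnc : (n.natAbs : ℂ) ≠ 0 := by exact_mod_cast hn'.ne'
  have habs : ‖(n : ℂ)‖ = n.natAbs := by rw [Complex.norm_intCast, Nat.cast_natAbs, Int.cast_abs]
  have e1 : (n : ℂ) ^ (-κ) = (n.natAbs : ℂ) ^ (-κ) := by
    rcases Int.natAbs_eq n with h | h
    · conv_lhs => rw [h]
      simp
    · conv_lhs => rw [h]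
      rw [Int.cast_neg, hκ.neg.neg_zpow, Int.cast_natCast]
  have e2 : τ.im / ‖(n : ℂ) * lat τ v‖ ^ 2 =
      (τ.im / ‖lat τ v‖ ^ 2) * ((n.natAbs : ℝ) ^ 2)⁻¹ := by
    rw [norm_mul, habs]; field_simp
  rw [latSummand, latSummand, lat_zsmul, mul_zpow, e1, e2, Complex.ofReal_mul,
    Complex.mul_cpow_ofReal_nonneg (by positivity) (by positivity), Complex.cpow_add _ _ hnc,
    Complex.cpow_intCast, mul_inv, zpow_neg]
  have e3 : (((((n.natAbs : ℝ) ^ 2)⁻¹ : ℝ) : ℂ)) ^ s = ((n.natAbs : ℂ) ^ (2 * s))⁻¹ := by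
    rw [Complex.ofReal_inv, Complex.inv_cpow, Complex.ofReal_pow, Complex.ofReal_natCast,
      ← Complex.natCast_cpow_natCast_mul]
    · norm_cast
    · rw [Complex.arg_ofReal_of_nonneg (by positivity)]
      exact Real.pi_pos.ne
  rw [e3]
  ring

theorem bottomRow_ne_zero (γ : SL(2, ℤ)) : bottomRow γ ≠ 0 := by
  intro h
  have hc := ModularGroup.bottom_row_coprime γ
  have h0 : γ 1 0 = 0 := congrArg Prod.fst h
  have h1 : γ 1 1 = 0 := congrArg Prod.snd h
  rw [h0, h1] at hc
  exact not_isCoprime_zero_zero hc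

/-- Distinct cosets have distinct chosen bottom rows, so this is a subfamily of the lattice sum. -/
theorem summable_eisTerm {κ : ℤ} {s : ℂ} (τ : ℍ) (hs : 2 < 2 * s.re + κ) :
    Summable fun q : Cosets => eisTerm κ s τ q := by
  have hinj : Function.Injective fun q : Cosets => bottomRow q.out := fun q q' h => by
    rw [← Quotient.out_eq q, ← Quotient.out_eq q']
    exact (Quotient.sound (rightRel_of_bottomRow (Or.inl h))).symm
  simp_rw [eisTerm_eq]
  exact (summable_latSummand τ hs).comp_injective hinj

theorem tsum_int_natAbs_cpow {z : ℂ} (hz : 1 < z.re) :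
    ∑' n : {n : ℤ // n ≠ 0}, ((n.1.natAbs : ℂ) ^ z)⁻¹ = 2 * riemannZeta z := by
  have hz0 : z ≠ 0 := fun h => by rw [h] at hz; norm_num at hz
  set f : ℤ → ℂ := fun n => ((n.natAbs : ℂ) ^ z)⁻¹ with hf
  have hsum : Summable fun n : ℕ => ((n : ℂ) ^ z)⁻¹ := by
    simpa using (Complex.summable_one_div_nat_cpow (p := z)).mpr hz
  have hsumf : Summable f := by
    refine Summable.of_nat_of_neg ?_ ?_ <;> simpa [hf] using hsum
  rw [show ∑' n : {n : ℤ // n ≠ 0}, ((n.1.natAbs : ℂ) ^ z)⁻¹ = ∑' n : ({0}ᶜ : Set ℤ), f n from rfl,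
    tsum_subtype_eq_of_support_subset (f := f) (s := {0}ᶜ) (by
      intro n hn h0
      rw [Set.mem_singleton_iff] at h0
      subst h0
      simp [hf, hz0] at hn),
    tsum_int_eq_zero_add_two_mul_tsum_pnat (fun n => by simp [hf]) hsumf,
    tsum_pnat_eq_tsum_succ (f := fun n : ℕ => f n),
    zeta_eq_tsum_one_div_nat_add_one_cpow hz]
  simp only [hf]
  norm_cast
  simp [hz0]

/-- Reindexing along `bijective_smul_bottomRow` splits the sum into a product of E_κ and ∑
|n|^(-2s-κ) over n ≠ 0. -/
theorem tsum_latSummand {κ : ℤ} (hκ : Even κ) {s : ℂ} (τ : ℍ) (hs : 2 < 2 * s.re + κ) :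
    ∑' v, latSummand κ s τ v = 2 * riemannZeta (2 * s + κ) * eis κ τ s := by
  have hsum := summable_latSummand τ hs
  have h0 := latSummand_zero κ s τ (index_ne_zero hs)
  have hsub : Function.support (latSummand κ s τ) ⊆ {v : ℤ × ℤ | v ≠ 0} := by
    intro v hv h
    subst h
    exact hv h0
  let e := Equiv.ofBijective _ bijective_smul_bottomRow
  have he : ∀ p : Cosets × {n : ℤ // n ≠ 0}, latSummand κ s τ (e p).1 =
      eisTerm κ s τ p.1 * ((p.2.1.natAbs : ℂ) ^ (2 * s + κ))⁻¹ := fun p => by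
    rw [eisTerm_eq, mul_comm, ← latSummand_zsmul hκ s τ p.2.2 (bottomRow_ne_zero _)]
    rfl
  have hre : 1 < (2 * s + κ).re := by
    simp
    linarith
  have hs2 : Summable fun p : Cosets × {n : ℤ // n ≠ 0} =>
      eisTerm κ s τ p.1 * ((p.2.1.natAbs : ℂ) ^ (2 * s + κ))⁻¹ := by
    simp_rw [← he]
    exact e.summable_iff.mpr (hsum.subtype {v : ℤ × ℤ | v ≠ 0})
  calc ∑' v, latSummand κ s τ v
      = ∑' v : {v : ℤ × ℤ | v ≠ 0}, latSummand κ s τ v :=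
        (tsum_subtype_eq_of_support_subset hsub).symm
    _ = ∑' p, latSummand κ s τ (e p).1 :=
        (e.tsum_eq (fun v : {v : ℤ × ℤ // v ≠ 0} => latSummand κ s τ v.1)).symm
    _ = 2 * riemannZeta (2 * s + κ) * eis κ τ s := by
        simp_rw [he]
        rw [hs2.tsum_prod]
        simp_rw [tsum_mul_left, tsum_mul_right, tsum_int_natAbs_cpow hre, eis]
        ring

/-! ### Theta series with a linear exponential factor -/

/-- The positive definite quadratic form `|c τ + d| ^ 2 / y` of determinant one. -/
def latForm (τ : ℍ) (v : ℤ × ℤ) : ℝ := ‖lat τ v‖ ^ 2 / τ.im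

theorem latForm_nonneg (τ : ℍ) (v : ℤ × ℤ) : 0 ≤ latForm τ v := by
  have := τ.im_pos
  unfold latForm; positivity

theorem latForm_pos (τ : ℍ) {v : ℤ × ℤ} (hv : v ≠ 0) : 0 < latForm τ v :=
  div_pos (pow_pos (norm_pos_iff.mpr (lat_ne_zero τ hv)) 2) τ.im_pos

theorem summable_exp_norm_lat (τ : ℍ) {a : ℝ} (ha : 0 < a) (b : ℝ) :
    Summable fun v => Real.exp (-a * ‖lat τ v‖ ^ 2 + b * ‖lat τ v‖) := by
  refine Summable.of_norm_bounded_eventually ((summable_norm_lat_rpow τ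
    (by norm_num : (2 : ℝ) < 3)).mul_left (6 * Real.exp ((b + 1) ^ 2 / (4 * a)))) ?_
  filter_upwards [(Set.finite_singleton (0 : ℤ × ℤ)).compl_mem_cofinite] with v hv
  have hx : 0 < ‖lat τ v‖ := norm_pos_iff.mpr (lat_ne_zero τ hv)
  set x := ‖lat τ v‖
  rw [Real.norm_eq_abs, Real.abs_exp, Real.rpow_neg hx.le]
  -- Completing the square bounds the exponent by a constant minus x; then exp(-x) ≤ 6x⁻³, and 3 > 2
  -- gives summability over the lattice.
  have h1 : -a * x ^ 2 + b * x ≤ (b + 1) ^ 2 / (4 * a) - x := by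
    have : (b + 1) ^ 2 / (4 * a) - x - (-a * x ^ 2 + b * x) = (2 * a * x - (b + 1)) ^ 2 / (4 * a) := by
      field_simp; ring
    have h2 : 0 ≤ (2 * a * x - (b + 1)) ^ 2 / (4 * a) := by positivity
    linarith
  have h3 : x ^ 3 / 6 ≤ Real.exp x := by
    simpa [Nat.factorial] using Real.pow_div_factorial_le_exp x hx.le 3
  calc Real.exp (-a * x ^ 2 + b * x) ≤ Real.exp ((b + 1) ^ 2 / (4 * a)) * (Real.exp x)⁻¹ := by
        rw [← Real.exp_neg, ← Real.exp_add]
        exact Real.exp_le_exp.mpr (by linarith)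
    _ ≤ Real.exp ((b + 1) ^ 2 / (4 * a)) * (x ^ 3 / 6)⁻¹ := by gcongr
    _ = _ := by
        rw [show (3 : ℝ) = (3 : ℕ) by norm_num, Real.rpow_natCast]
        field_simp

theorem summable_exp_latForm (τ : ℍ) {t : ℝ} (ht : 0 < t) (b : ℝ) :
    Summable fun v => Real.exp (-Real.pi * latForm τ v * t) * Real.exp (b * ‖lat τ v‖) := by
  have hy := τ.im_pos
  refine (summable_exp_norm_lat τ (a := Real.pi * t / τ.im) (by positivity) b).congr fun v => ?_
  rw [← Real.exp_add, latForm]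
  congr 1
  ring

/-- The terms of the theta series with a linear exponential factor. -/
def thetaTerm (τ : ℍ) (t : ℝ) (u : ℂ) (v : ℤ × ℤ) : ℂ :=
  Complex.exp (u * lat τ v) * Real.exp (-Real.pi * latForm τ v * t)

theorem summable_thetaTerm (τ : ℍ) {t : ℝ} (ht : 0 < t) (u : ℂ) :
    Summable (thetaTerm τ t u) := by
  refine Summable.of_norm ((summable_exp_latForm τ ht ‖u‖).of_nonneg_of_le
    (fun v => norm_nonneg _) fun v => ?_)
  rw [thetaTerm, norm_mul, mul_comm, Complex.norm_real, Real.norm_eq_abs, Real.abs_exp,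
    Complex.norm_exp]
  gcongr
  rw [← norm_mul]
  exact Complex.re_le_norm _

theorem summable_norm_exp_quadratic {a : ℝ} (ha : 0 < a) (b : ℂ) :
    Summable fun n : ℤ => ‖Complex.exp (-Real.pi * a * n ^ 2 + 2 * Real.pi * b * n)‖ := by
  have h := (summable_jacobiTheta₂_term_iff (-Complex.I * b) (Complex.I * a)).mpr (by simpa using ha)
  refine h.norm.congr fun n => ?_
  rw [jacobiTheta₂_term]
  congr 2
  linear_combination (-2 * Real.pi * n * b + Real.pi * n ^ 2 * a) * Complex.I_sq

theorem latForm_mk (τ : ℍ) (c d : ℤ) :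
    (latForm τ (c, d) : ℂ) = ((c * τ.re + d) ^ 2 + (c * τ.im) ^ 2) / τ.im := by
  rw [latForm, Complex.sq_norm, Complex.normSq_apply]
  simp [lat]
  ring

/-- The series obtained from the theta series by Poisson summation in one variable. -/
def mixedTerm (τ : ℍ) (t : ℝ) (u : ℂ) (c n : ℤ) : ℂ :=
  Complex.exp (-Real.pi * ((t * τ.im : ℝ) : ℂ) * c ^ 2 +
      2 * Real.pi * (Complex.I * u * τ.im / (2 * Real.pi)) * c) *
    Complex.exp (-Real.pi * ((τ.im / t : ℝ) : ℂ) * (n + Complex.I * u / (2 * Real.pi)) ^ 2) *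
    Complex.exp (2 * Real.pi * Complex.I * (n * c * τ.re))

theorem coe_eq_re_add_im (τ : ℍ) : (τ : ℂ) = τ.re + τ.im * Complex.I :=
  (Complex.re_add_im (τ : ℂ)).symm

/-- Poisson summation in d for fixed c: once K, which is independent of d, is factored out, the
terms are Gaussian in d with a linear exponent. -/
theorem tsum_thetaTerm_snd (τ : ℍ) {t : ℝ} (ht : 0 < t) (u : ℂ) (c : ℤ) :
    ∑' d : ℤ, thetaTerm τ t u (c, d) =
      1 / ((t / τ.im : ℝ) : ℂ) ^ (1 / 2 : ℂ) * ∑' n : ℤ, mixedTerm τ t u c n := by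
  have hy := τ.im_pos
  have hyc : (τ.im : ℂ) ≠ 0 := by exact_mod_cast hy.ne'
  have htc : (t : ℂ) ≠ 0 := by exact_mod_cast ht.ne'
  have hpi : (Real.pi : ℂ) ≠ 0 := by exact_mod_cast Real.pi_ne_zero
  have hP := Complex.tsum_exp_neg_quadratic (a := ((t / τ.im : ℝ) : ℂ))
    (by rw [Complex.ofReal_re]; positivity) (u / (2 * Real.pi) - t * c * τ.re / τ.im)
  set K : ℂ := Complex.exp (-Real.pi * t * c ^ 2 * (τ.re ^ 2 + τ.im ^ 2) / τ.im + u * c * τ) with hK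
  have h1 : ∀ d : ℤ, thetaTerm τ t u (c, d) = K * Complex.exp
      (-Real.pi * ((t / τ.im : ℝ) : ℂ) * d ^ 2 +
        2 * Real.pi * (u / (2 * Real.pi) - t * c * τ.re / τ.im) * d) := fun d => by
    rw [thetaTerm, hK, Complex.ofReal_exp, ← Complex.exp_add, ← Complex.exp_add]
    congr 1
    push_cast
    rw [latForm_mk, lat]
    field_simp
    ring
  have h2 : ∀ n : ℤ, mixedTerm τ t u c n = K * Complex.exp
      (-Real.pi / ((t / τ.im : ℝ) : ℂ) *
        (n + Complex.I * (u / (2 * Real.pi) - t * c * τ.re / τ.im)) ^ 2) := fun n => by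
    rw [mixedTerm, hK, ← Complex.exp_add, ← Complex.exp_add, ← Complex.exp_add]
    congr 1
    rw [coe_eq_re_add_im]
    push_cast
    field_simp
    ring_nf
    simp only [Complex.I_sq]
    ring
  simp_rw [h1, h2, tsum_mul_left]
  rw [hP]
  ring

/-- Poisson summation in c for fixed n returns to theta terms. No factor exp(const·u²) survives,
because the linear form cτ+d is isotropic for the dual quadratic form; this is what makes (cτ+d)^N
harmonic. -/
theorem tsum_mixedTerm_fst (τ : ℍ) {t : ℝ} (ht : 0 < t) (u : ℂ) (n : ℤ) :
    ∑' c : ℤ, mixedTerm τ t u c n =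
      1 / ((t * τ.im : ℝ) : ℂ) ^ (1 / 2 : ℂ) * ∑' m : ℤ, thetaTerm τ (1 / t) (-u / t) (n, -m) := by
  have hy := τ.im_pos
  have hyc : (τ.im : ℂ) ≠ 0 := by exact_mod_cast hy.ne'
  have htc : (t : ℂ) ≠ 0 := by exact_mod_cast ht.ne'
  have hpi : (Real.pi : ℂ) ≠ 0 := by exact_mod_cast Real.pi_ne_zero
  have hP := Complex.tsum_exp_neg_quadratic (a := ((t * τ.im : ℝ) : ℂ))
    (by rw [Complex.ofReal_re]; positivity)
    (Complex.I * u * τ.im / (2 * Real.pi) + Complex.I * n * τ.re)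
  set K : ℂ := Complex.exp
    (-Real.pi * ((τ.im / t : ℝ) : ℂ) * (n + Complex.I * u / (2 * Real.pi)) ^ 2) with hK
  have h1 : ∀ c : ℤ, mixedTerm τ t u c n = K * Complex.exp
      (-Real.pi * ((t * τ.im : ℝ) : ℂ) * c ^ 2 +
        2 * Real.pi * (Complex.I * u * τ.im / (2 * Real.pi) + Complex.I * n * τ.re) * c) :=
    fun c => by
    rw [mixedTerm, hK, ← Complex.exp_add, ← Complex.exp_add, ← Complex.exp_add]
    congr 1
    ring
  have h2 : ∀ m : ℤ, thetaTerm τ (1 / t) (-u / t) (n, -m) = K * Complex.exp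
      (-Real.pi / ((t * τ.im : ℝ) : ℂ) *
        (m + Complex.I * (Complex.I * u * τ.im / (2 * Real.pi) + Complex.I * n * τ.re)) ^ 2) :=
    fun m => by
    rw [thetaTerm, hK, Complex.ofReal_exp, ← Complex.exp_add, ← Complex.exp_add]
    congr 1
    push_cast
    rw [latForm_mk, lat, coe_eq_re_add_im]
    push_cast
    field_simp
    ring_nf
    simp only [Complex.I_sq, Complex.I_pow_four]
    ring
  simp_rw [h1, h2, tsum_mul_left]
  rw [hP]
  ring

/-- The only factor coupling c and n is unimodular, so the norms split as a product of two summable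
Gaussians. This licenses the exchange of sums between the two Poisson summations. -/
theorem summable_mixedTerm (τ : ℍ) {t : ℝ} (ht : 0 < t) (u : ℂ) :
    Summable (Function.uncurry (mixedTerm τ t u)) := by
  have hy := τ.im_pos
  have hpi : (Real.pi : ℂ) ≠ 0 := by exact_mod_cast Real.pi_ne_zero
  have hA := summable_norm_exp_quadratic (a := t * τ.im) (by positivity)
    (Complex.I * u * τ.im / (2 * Real.pi))
  have hB : Summable fun n : ℤ => ‖Complex.exp
      (-Real.pi * ((τ.im / t : ℝ) : ℂ) * (n + Complex.I * u / (2 * Real.pi)) ^ 2)‖ := by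
    have := (summable_norm_exp_quadratic (a := τ.im / t) (by positivity)
      (-((τ.im / t : ℝ) : ℂ) * Complex.I * u / (2 * Real.pi))).mul_left
      ‖Complex.exp (-Real.pi * ((τ.im / t : ℝ) : ℂ) * (Complex.I * u / (2 * Real.pi)) ^ 2)‖
    refine this.congr fun n => ?_
    rw [← norm_mul, ← Complex.exp_add]
    congr 2
    field_simp
    ring
  refine Summable.of_norm ((hA.mul_of_nonneg hB (fun _ => norm_nonneg _)
    (fun _ => norm_nonneg _)).congr fun p => ?_)
  have : ‖Complex.exp (2 * Real.pi * Complex.I * (p.2 * p.1 * τ.re))‖ = 1 := by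
    rw [show 2 * Real.pi * Complex.I * (p.2 * p.1 * τ.re : ℂ) =
      ((2 * Real.pi * (p.2 * p.1 * τ.re) : ℝ) : ℂ) * Complex.I by push_cast; ring]
    exact Complex.norm_exp_ofReal_mul_I _
  rw [Function.uncurry, mixedTerm, norm_mul, norm_mul, this, mul_one]

/-- The functional equation of the theta series with a linear exponential factor. -/
theorem tsum_thetaTerm (τ : ℍ) {t : ℝ} (ht : 0 < t) (u : ℂ) :
    ∑' v, thetaTerm τ t u v = 1 / t * ∑' v, thetaTerm τ (1 / t) (-u / t) v := by
  have hy := τ.im_pos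
  have hyc : (τ.im : ℂ) ≠ 0 := by exact_mod_cast hy.ne'
  have htc : (t : ℂ) ≠ 0 := by exact_mod_cast ht.ne'
  -- The two Poisson factors (t/y)^(-1/2) and (ty)^(-1/2) multiply to 1/t.
  have hK : 1 / ((t / τ.im : ℝ) : ℂ) ^ (1 / 2 : ℂ) * (1 / ((t * τ.im : ℝ) : ℂ) ^ (1 / 2 : ℂ)) =
      1 / t := by
    rw [div_mul_div_comm, one_mul, ← Complex.mul_cpow_ofReal_nonneg (by positivity) (by positivity),
      ← Complex.ofReal_mul, show t / τ.im * (t * τ.im) = t * t by field_simp, Complex.ofReal_mul,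
      Complex.mul_cpow_ofReal_nonneg ht.le ht.le, ← Complex.cpow_add _ _ htc]
    norm_num
  have ht' : 0 < 1 / t := by positivity
  have e : Summable fun p : ℤ × ℤ => thetaTerm τ (1 / t) (-u / t) (p.1, -p.2) :=
    ((Equiv.refl ℤ).prodCongr (Equiv.neg ℤ)).summable_iff.mpr (summable_thetaTerm τ ht' (-u / t))
  rw [(summable_thetaTerm τ ht u).tsum_prod]
  simp_rw [tsum_thetaTerm_snd τ ht u, tsum_mul_left]
  rw [← (summable_mixedTerm τ ht u).tsum_comm]
  simp_rw [tsum_mixedTerm_fst τ ht u, tsum_mul_left]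
  rw [← mul_assoc, hK, ← e.tsum_prod]
  congr 1
  exact ((Equiv.refl ℤ).prodCongr (Equiv.neg ℤ)).tsum_eq (thetaTerm τ (1 / t) (-u / t))

/-! ### Theta series with harmonic coefficients -/

/-- The theta series with harmonic coefficient `(c τ + d) ^ N`. -/
def harmTheta (N : ℕ) (τ : ℍ) (t : ℝ) : ℂ :=
  ∑' v, lat τ v ^ N * (Real.exp (-Real.pi * latForm τ v * t) : ℂ)

theorem summable_norm_harmTheta (N : ℕ) (τ : ℍ) {t : ℝ} (ht : 0 < t) :
    Summable fun v => ‖lat τ v‖ ^ N * Real.exp (-Real.pi * latForm τ v * t) := by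
  refine ((summable_exp_latForm τ ht 1).mul_left (N.factorial : ℝ)).of_nonneg_of_le
    (fun v => by positivity) fun v => ?_
  have h := Real.pow_div_factorial_le_exp ‖lat τ v‖ (norm_nonneg _) N
  rw [div_le_iff₀ (by positivity)] at h
  rw [one_mul, mul_left_comm, mul_comm]
  gcongr
  linarith

theorem summable_harmTheta (N : ℕ) (τ : ℍ) {t : ℝ} (ht : 0 < t) :
    Summable fun v => lat τ v ^ N * (Real.exp (-Real.pi * latForm τ v * t) : ℂ) := by
  refine Summable.of_norm ((summable_norm_harmTheta N τ ht).congr fun v => ?_)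
  rw [norm_mul, norm_pow, Complex.norm_real, Real.norm_eq_abs, Real.abs_exp]

/-- Expand exp(u(cτ+d)) in powers of u. The double family is absolutely summable, since summing
norms over N first gives exp(‖u‖·|cτ+d|) against a Gaussian. -/
theorem hasSum_tsum_thetaTerm (τ : ℍ) {t : ℝ} (ht : 0 < t) (u : ℂ) :
    HasSum (fun N : ℕ => u ^ N * ((N.factorial : ℂ)⁻¹ * harmTheta N τ t))
      (∑' v, thetaTerm τ t u v) := by
  set F : (ℤ × ℤ) × ℕ → ℂ := fun p => (u * lat τ p.1) ^ p.2 / p.2.factorial *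
    Real.exp (-Real.pi * latForm τ p.1 * t) with hF
  have hnorm : ∀ p, ‖F p‖ = (‖u‖ * ‖lat τ p.1‖) ^ p.2 / p.2.factorial *
      Real.exp (-Real.pi * latForm τ p.1 * t) := fun p => by
    rw [hF, norm_mul, norm_div, norm_pow, norm_mul, Complex.norm_real, Real.norm_eq_abs,
      Real.abs_exp, Complex.norm_natCast]
  have hsum : Summable F := by
    refine Summable.of_norm ((summable_prod_of_nonneg fun p => norm_nonneg _).mpr ⟨fun v => ?_, ?_⟩)
    · simp_rw [hnorm]
      exact (Real.summable_pow_div_factorial _).mul_right _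
    · refine (summable_exp_latForm τ ht ‖u‖).congr fun v => ?_
      simp_rw [hnorm]
      rw [tsum_mul_right, mul_comm, Real.exp_eq_exp_ℝ, NormedSpace.exp_eq_tsum_div]
  have h1 : ∀ v, HasSum (fun N : ℕ => F (v, N)) (thetaTerm τ t u v) := fun v => by
    have := NormedSpace.expSeries_div_hasSum_exp (u * lat τ v)
    rw [← Complex.exp_eq_exp_ℂ] at this
    exact this.mul_right _
  have h2 : ∀ N : ℕ, HasSum (fun v => F (v, N)) (u ^ N * ((N.factorial : ℂ)⁻¹ * harmTheta N τ t)) :=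
    fun N => by
    have := ((summable_harmTheta N τ ht).hasSum.mul_left (N.factorial : ℂ)⁻¹).mul_left (u ^ N)
    refine this.congr_fun fun v => ?_
    simp only [hF, mul_pow]
    ring
  rw [(hsum.hasSum.prod_fiberwise h1).tsum_eq]
  exact ((Equiv.prodComm ℕ (ℤ × ℤ)).hasSum_iff.mpr hsum.hasSum).prod_fiberwise h2

theorem coeff_unique {a b : ℕ → ℂ} {f : ℂ → ℂ} (ha : ∀ u, HasSum (fun n => u ^ n * a n) (f u))
    (hb : ∀ u, HasSum (fun n => u ^ n * b n) (f u)) : a = b := by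
  have key : ∀ c : ℕ → ℂ, (∀ u, HasSum (fun n => u ^ n * c n) (f u)) →
      HasFPowerSeriesAt f (FormalMultilinearSeries.ofScalars ℂ c) 0 := fun c hc => by
    rw [hasFPowerSeriesAt_iff]
    refine Filter.Eventually.of_forall fun z => ?_
    simpa [FormalMultilinearSeries.coeff_ofScalars] using hc z
  have h := (key a ha).eq_formalMultilinearSeries (key b hb)
  funext n
  simpa [FormalMultilinearSeries.coeff_ofScalars] using congrArg (fun p => p.coeff n) h

/-- The functional equation of the theta series with harmonic coefficients. -/
theorem harmTheta_one_div {N : ℕ} (hN : Even N) (τ : ℍ) {t : ℝ} (ht : 0 < t) :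
    harmTheta N τ (1 / t) = t ^ (N + 1) * harmTheta N τ t := by
  have htc : (t : ℂ) ≠ 0 := by exact_mod_cast ht.ne'
  have h := coeff_unique (hasSum_tsum_thetaTerm τ ht) (b := fun n => (n.factorial : ℂ)⁻¹ *
      ((1 / t) * (-1 / t) ^ n * harmTheta n τ (1 / t))) fun u => by
    rw [tsum_thetaTerm τ ht u]
    have := (hasSum_tsum_thetaTerm τ (one_div_pos.mpr ht) (-u / t)).mul_left (1 / (t : ℂ))
    refine this.congr_fun fun n => ?_
    rw [show -u / (t : ℂ) = u * (-1 / t) by ring, mul_pow]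
    ring
  -- The coefficient of u^N gives θ_N(t) = (1/t)(-1/t)^N θ_N(1/t) for θ_N = `harmTheta N τ`, and
  -- evenness of N drops the sign.
  have h2 := congrFun h N
  have hf : (N.factorial : ℂ)⁻¹ ≠ 0 := inv_ne_zero (by exact_mod_cast N.factorial_ne_zero)
  rw [mul_right_inj' hf, div_pow, hN.neg_one_pow] at h2
  rw [h2]
  field_simp
  ring

theorem continuousOn_harmTheta (N : ℕ) (τ : ℍ) :
    ContinuousOn (harmTheta N τ) (Set.Ioi 0) := by
  intro t ht
  have ht' : 0 < t / 2 := half_pos ht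
  refine ContinuousAt.continuousWithinAt ?_
  have : ContinuousOn (harmTheta N τ) (Set.Ioi (t / 2)) := by
    refine continuousOn_tsum (fun v => by fun_prop) (summable_norm_harmTheta N τ ht')
      fun v x hx => ?_
    rw [norm_mul, norm_pow, Complex.norm_real, Real.norm_eq_abs, Real.abs_exp]
    refine mul_le_mul_of_nonneg_left (Real.exp_le_exp.mpr ?_) (by positivity)
    refine mul_le_mul_of_nonpos_left (le_of_lt hx) ?_
    rw [neg_mul]
    exact neg_nonpos.mpr (mul_nonneg Real.pi_pos.le (latForm_nonneg τ v))
  exact this.continuousAt (Ioi_mem_nhds (half_lt_self ht))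

/-! ### Mellin transform and continuation of the harmonic lattice zeta function -/

/-- The coefficients of the theta series without its constant term. -/
def harmCoeff (N : ℕ) (τ : ℍ) (v : ℤ × ℤ) : ℂ := if v = 0 then 0 else lat τ v ^ N

theorem norm_harmCoeff_le (N : ℕ) (τ : ℍ) (v : ℤ × ℤ) : ‖harmCoeff N τ v‖ ≤ ‖lat τ v‖ ^ N := by
  unfold harmCoeff
  split_ifs
  · simp
  · rw [norm_pow]

/-- The term at v = 0 is 0^N, that is 1 for N = 0 and 0 otherwise. -/
theorem hasSum_harmTheta_sub (N : ℕ) (τ : ℍ) {t : ℝ} (ht : 0 < t) :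
    HasSum (fun v => harmCoeff N τ v * (Real.exp (-Real.pi * latForm τ v * t) : ℂ))
      (harmTheta N τ t - 0 ^ N) := by
  have h1 := (summable_harmTheta N τ ht).hasSum
  have h2 := hasSum_ite_eq (0 : ℤ × ℤ) ((0 : ℂ) ^ N)
  refine (h1.sub h2).congr_fun fun v => ?_
  unfold harmCoeff
  split_ifs with h
  · subst h; simp [lat_zero, latForm]
  · simp

/-- For v ≠ 0 one has πQ(v) ≥ a > 0, hence πQ(v)t ≥ πQ(v) + a(t-1) for t ≥ 1. The sum is then at
most exp(-at) times a constant read off at t = 1. -/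
theorem harmTheta_sub_isBigO (N : ℕ) (τ : ℍ) (r : ℝ) :
    (fun t => harmTheta N τ t - 0 ^ N) =O[Filter.atTop] fun t : ℝ => t ^ r := by
  obtain ⟨δ, hδ, h⟩ := exists_le_norm_lat τ
  have hy := τ.im_pos
  set a : ℝ := Real.pi * (δ ^ 2 / τ.im) with ha
  have ha0 : 0 < a := by have := Real.pi_pos; positivity
  have hS := summable_norm_harmTheta N τ one_pos
  refine Asymptotics.IsBigO.trans (g := fun t => Real.exp (-a * t)) ?_
    (isLittleO_exp_neg_mul_rpow_atTop ha0 r).isBigO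
  refine Asymptotics.IsBigO.of_bound ((∑' v, ‖lat τ v‖ ^ N *
    Real.exp (-Real.pi * latForm τ v * 1)) * Real.exp a) ?_
  filter_upwards [Filter.eventually_ge_atTop 1] with t ht
  rw [← (hasSum_harmTheta_sub N τ (by linarith : 0 < t)).tsum_eq, Real.norm_eq_abs, Real.abs_exp,
    mul_assoc, ← Real.exp_add, ← tsum_mul_right]
  refine tsum_of_norm_bounded (hS.mul_right _).hasSum fun v => ?_
  rw [norm_mul, Complex.norm_real, Real.norm_eq_abs, Real.abs_exp,
    mul_assoc (‖lat τ v‖ ^ N), ← Real.exp_add]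
  by_cases hv : v = 0
  · rw [harmCoeff, if_pos hv, norm_zero, zero_mul]
    positivity
  refine mul_le_mul (norm_harmCoeff_le N τ v) (Real.exp_le_exp.mpr ?_) (Real.exp_nonneg _)
    (by positivity)
  have h3 : a ≤ Real.pi * latForm τ v := by
    rw [ha, latForm]
    have := h v hv
    have := Real.pi_pos
    gcongr
  nlinarith

/-- The theta series with harmonic coefficients as a pair of functions related by a functional
equation. -/
def harmPair {N : ℕ} (hN : Even N) (τ : ℍ) : WeakFEPair ℂ where
  f := harmTheta N τ
  g := harmTheta N τ
  k := N + 1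
  ε := 1
  f₀ := 0 ^ N
  g₀ := 0 ^ N
  hf_int := (continuousOn_harmTheta N τ).locallyIntegrableOn measurableSet_Ioi
  hg_int := (continuousOn_harmTheta N τ).locallyIntegrableOn measurableSet_Ioi
  hk := by positivity
  hε := one_ne_zero
  h_feq t ht := by
    rw [harmTheta_one_div hN τ ht, one_mul, smul_eq_mul]
    congr 1
    rw [show (N : ℝ) + 1 = ((N + 1 : ℕ) : ℝ) by push_cast; ring, Real.rpow_natCast]
    push_cast; rfl
  hf_top := harmTheta_sub_isBigO N τ
  hg_top := harmTheta_sub_isBigO N τ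

/-- For N = 0 the constant term is nonzero and convergence needs Re w > 1, the weight of the pair;
for N > 0 it vanishes and the Mellin integral converges everywhere. -/
theorem hasMellin_harmPair {N : ℕ} (hN : Even N) (τ : ℍ) {w : ℂ} (hw : N + 2 < 2 * w.re) :
    HasMellin (fun t => harmTheta N τ t - 0 ^ N) w ((harmPair hN τ).Λ w) := by
  by_cases h0 : N = 0
  · subst h0
    refine (harmPair hN τ).hasMellin ?_
    simp only [harmPair]
    push_cast at hw ⊢
    linarith
  · have h0' : (0 : ℂ) ^ N = 0 := zero_pow h0
    have hP : IsStrongFEPair (harmPair hN τ) := ⟨h0', h0'⟩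
    simp_rw [h0', sub_zero]
    exact hP.hasMellin w

/-- The Mellin transform of the theta series is the lattice zeta function with harmonic
coefficients. -/
theorem hasSum_harmCoeff_div {N : ℕ} (hN : Even N) (τ : ℍ) {w : ℂ} (hw : N + 2 < 2 * w.re) :
    HasSum (fun v => (Real.pi : ℂ) ^ (-w) * Complex.Gamma w * harmCoeff N τ v /
      (latForm τ v : ℂ) ^ w) ((harmPair hN τ).Λ w) := by
  have hw0 : 0 < w.re := by
    have : (0 : ℝ) ≤ N := N.cast_nonneg
    linarith
  have hy := τ.im_pos
  rw [← (hasMellin_harmPair hN τ hw).2]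
  refine hasSum_mellin_pi_mul (fun v => ?_) hw0
    (fun t ht => hasSum_harmTheta_sub N τ ht) ?_
  · by_cases hv : v = 0
    · left; rw [harmCoeff, if_pos hv]
    · right; exact latForm_pos τ hv
  · refine ((summable_norm_lat_rpow τ (a := 2 * w.re - N) (by linarith)).mul_left
      (τ.im ^ w.re)).of_nonneg_of_le
      (fun v => div_nonneg (norm_nonneg _) (Real.rpow_nonneg (latForm_nonneg τ v) _)) fun v => ?_
    by_cases hv : v = 0
    · rw [harmCoeff, if_pos hv, norm_zero, zero_div]
      positivity
    have hl := norm_pos_iff.mpr (lat_ne_zero τ hv)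
    refine le_of_eq ?_
    rw [harmCoeff, if_neg hv, norm_pow, latForm, Real.div_rpow (by positivity) hy.le,
      ← Real.rpow_natCast _ 2, ← Real.rpow_mul hl.le, neg_sub, Real.rpow_sub hl,
      Real.rpow_natCast]
    push_cast
    field_simp

theorem differentiable_inv_Gamma : Differentiable ℂ fun w => (Complex.Gamma w)⁻¹ :=
  Complex.differentiable_one_div_Gamma

theorem hasSum_harmCoeff_div_latForm {N : ℕ} (hN : Even N) (τ : ℍ) {w : ℂ}
    (hw : N + 2 < 2 * w.re) :
    HasSum (fun v => harmCoeff N τ v / (latForm τ v : ℂ) ^ w)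
      ((Real.pi : ℂ) ^ w * (Complex.Gamma w)⁻¹ * (harmPair hN τ).Λ w) := by
  have hw0 : 0 < w.re := by
    have : (0 : ℝ) ≤ N := N.cast_nonneg
    linarith
  have hpi : (Real.pi : ℂ) ≠ 0 := by exact_mod_cast Real.pi_ne_zero
  have hpw : (Real.pi : ℂ) ^ w ≠ 0 := by simp [Complex.cpow_eq_zero_iff, hpi]
  have hG : Complex.Gamma w ≠ 0 := Complex.Gamma_ne_zero_of_re_pos hw0
  refine ((hasSum_harmCoeff_div hN τ hw).mul_left _).congr_fun fun v => ?_
  rw [Complex.cpow_neg]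
  field_simp

/-- The meromorphic continuation of the lattice zeta function with harmonic coefficients. -/
theorem exists_continuation_harmCoeff {N : ℕ} (hN : Even N) (τ : ℍ) :
    ∃ G : ℂ → ℂ, (∀ w : ℂ, N + 2 < 2 * w.re →
        HasSum (fun v => harmCoeff N τ v / (latForm τ v : ℂ) ^ w) (G w)) ∧
      (∀ w, MeromorphicAt G w) ∧
      (∀ w, w ≠ 1 ∨ N ≠ 0 → 0 ≤ meromorphicOrderAt G w) ∧
      (∀ w, ((-1 : ℤ) : WithTop ℤ) ≤ meromorphicOrderAt G w) := by
  have hpi : (Real.pi : ℂ) ≠ 0 := by exact_mod_cast Real.pi_ne_zero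
  have hpd : Differentiable ℂ fun w : ℂ => (Real.pi : ℂ) ^ w := fun w =>
    differentiableAt_id.const_cpow (Or.inl hpi)
  have hΓ := differentiable_inv_Gamma
  by_cases h0 : N = 0
  · subst h0
    have hΛ := (harmPair hN τ).differentiable_Λ₀
    -- H is (w-1)·π^w·Γ(w)⁻¹·(Λ₀(w) - 1/w - 1/(1-w)) with the apparent pole at 0 absorbed through
    -- wΓ(w) = Γ(w+1), so that H is entire and H/(w-1) is the continuation.
    set H : ℂ → ℂ := fun w => (Real.pi : ℂ) ^ w * ((w - 1) * ((Complex.Gamma w)⁻¹ *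
      (harmPair hN τ).Λ₀ w) - (w - 1) * (Complex.Gamma (w + 1))⁻¹ + (Complex.Gamma w)⁻¹) with hH
    have hHd : Differentiable ℂ H := by
      have h1 : Differentiable ℂ fun w => (Complex.Gamma (w + 1))⁻¹ :=
        hΓ.comp (differentiable_id.add_const 1)
      exact hpd.mul ((((differentiable_id.sub_const 1).mul (hΓ.mul hΛ)).sub
        ((differentiable_id.sub_const 1).mul h1)).add hΓ)
    have hHa : ∀ w, AnalyticAt ℂ H w := fun w => hHd.analyticAt w
    have hla : ∀ w : ℂ, AnalyticAt ℂ (fun w : ℂ => w - 1) w := fun w => by fun_prop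
    have hord1 : meromorphicOrderAt (fun w => H w * (w - 1)⁻¹) 1 =
        meromorphicOrderAt H 1 + ((-1 : ℤ) : WithTop ℤ) := by
      rw [show (fun w => H w * (w - 1)⁻¹) = H * (fun w => w - 1)⁻¹ from rfl,
        meromorphicOrderAt_mul (hHa 1).meromorphicAt (hla 1).meromorphicAt.inv,
        meromorphicOrderAt_inv, meromorphicOrderAt_id_sub_const]
      rfl
    have hne : ∀ w : ℂ, w ≠ 1 → 0 ≤ meromorphicOrderAt (fun w => H w * (w - 1)⁻¹) w :=
      fun w hw => ((hHa w).mul ((hla w).inv (sub_ne_zero.mpr hw))).meromorphicOrderAt_nonneg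
    refine ⟨fun w => H w * (w - 1)⁻¹, fun w hw => ?_, fun w => ?_, fun w hw => ?_, fun w => ?_⟩
    · convert hasSum_harmCoeff_div_latForm hN τ hw using 1
      have hw0 : 1 < w.re := by
        push_cast at hw
        linarith
      have hwn : w ≠ 0 := fun h => by rw [h] at hw0; norm_num at hw0
      have hw1 : w - 1 ≠ 0 := fun h => by
        rw [sub_eq_zero.mp h] at hw0; norm_num at hw0
      have hw2 : 1 - w ≠ 0 := fun h => hw1 (by linear_combination -h)
      have hGn : Complex.Gamma w ≠ 0 := Complex.Gamma_ne_zero_of_re_pos (by linarith)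
      have e : (harmPair hN τ).Λ w = (harmPair hN τ).Λ₀ w - 1 / w - 1 / (1 - w) := by
        simp [WeakFEPair.Λ, harmPair]
      simp only [hH]
      rw [e, Complex.Gamma_add_one w hwn, show 1 - w = -(w - 1) by ring]
      field_simp
      ring
    · exact (hHa w).meromorphicAt.mul (hla w).meromorphicAt.inv
    · exact hne w (hw.resolve_right (fun h => h rfl))
    · by_cases hw : w = 1
      · subst hw
        rw [hord1]
        exact le_add_of_nonneg_left (hHa 1).meromorphicOrderAt_nonneg
      · exact le_trans (by decide) (hne w hw)
  -- Without a constant term Λ is itself entire, so no pole occurs.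
  · have h0' : (0 : ℂ) ^ N = 0 := zero_pow h0
    have hP : IsStrongFEPair (harmPair hN τ) := ⟨h0', h0'⟩
    have hd : Differentiable ℂ fun w =>
        (Real.pi : ℂ) ^ w * (Complex.Gamma w)⁻¹ * (harmPair hN τ).Λ w :=
      (hpd.mul hΓ).mul hP.differentiable_Λ
    exact ⟨_, fun w hw => hasSum_harmCoeff_div_latForm hN τ hw,
      fun w => (hd.analyticAt w).meromorphicAt,
      fun w _ => (hd.analyticAt w).meromorphicOrderAt_nonneg,
      fun w => le_trans (by decide) (hd.analyticAt w).meromorphicOrderAt_nonneg⟩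

/-! ### Weights of either sign -/

theorem im_div_sq_norm_lat_cpow (s : ℂ) (τ : ℍ) (v : ℤ × ℤ) :
    (((τ.im / ‖lat τ v‖ ^ 2 : ℝ) : ℂ)) ^ s = ((latForm τ v : ℂ) ^ s)⁻¹ := by
  rw [← Complex.inv_cpow, ← Complex.ofReal_inv, latForm, inv_div]
  rw [Complex.arg_ofReal_of_nonneg (latForm_nonneg τ v)]
  exact Real.pi_pos.ne

theorem latSummand_of_nonpos (N : ℕ) {s : ℂ} (τ : ℍ) (hs : 2 < 2 * s.re + (-N : ℤ))
    (v : ℤ × ℤ) :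
    latSummand (-N : ℤ) s τ v = harmCoeff N τ v / (latForm τ v : ℂ) ^ s := by
  by_cases hv : v = 0
  · rw [hv, latSummand_zero _ s τ (index_ne_zero hs), harmCoeff, if_pos rfl, zero_div]
  · rw [latSummand, harmCoeff, if_neg hv, neg_neg, zpow_natCast, im_div_sq_norm_lat_cpow,
      div_eq_mul_inv]

/-- The reflection `-conj τ` of a point of the upper half plane. -/
def reflect (τ : ℍ) : ℍ := ⟨-starRingEnd ℂ (τ : ℂ), by simpa using τ.im_pos⟩

theorem im_reflect (τ : ℍ) : (reflect τ).im = τ.im := by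
  change (-starRingEnd ℂ (τ : ℂ)).im = (τ : ℂ).im
  simp

theorem lat_reflect (τ : ℍ) (v : ℤ × ℤ) :
    lat (reflect τ) (v.1, -v.2) = -starRingEnd ℂ (lat τ v) := by
  change (v.1 : ℂ) * (-starRingEnd ℂ (τ : ℂ)) + ((-v.2 : ℤ) : ℂ) = _
  simp [lat]
  ring

theorem latForm_reflect (τ : ℍ) (v : ℤ × ℤ) :
    latForm (reflect τ) (v.1, -v.2) = latForm τ v := by
  rw [latForm, latForm, im_reflect, lat_reflect, norm_neg, Complex.norm_conj]

/-- Since yQ = (cτ+d)·conj(cτ+d), the factor (cτ+d)^(-N) equals conj(cτ+d)^N / (y^N Q^N). Up to a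
sign killed by evenness, the conjugate is a lattice element of -conj τ, so the harmonic series
applies at w = s+N. -/
theorem latSummand_of_nonneg {N : ℕ} (hN : Even N) {s : ℂ} (τ : ℍ) (hs : 2 < 2 * s.re + (N : ℤ))
    (v : ℤ × ℤ) :
    latSummand (N : ℤ) s τ v = ((τ.im : ℂ) ^ N)⁻¹ * (harmCoeff N (reflect τ) (v.1, -v.2) /
      (latForm (reflect τ) (v.1, -v.2) : ℂ) ^ (s + N)) := by
  by_cases hv : v = 0
  · rw [hv, latSummand_zero _ s τ (index_ne_zero hs), harmCoeff, if_pos (by simp), zero_div,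
      mul_zero]
  · have hv' : (v.1, -v.2) ≠ (0 : ℤ × ℤ) := fun h =>
      hv (Prod.ext (Prod.mk.inj h).1 (neg_eq_zero.mp (Prod.mk.inj h).2))
    have hf := latForm_pos τ hv
    have hfc : (latForm τ v : ℂ) ≠ 0 := by exact_mod_cast hf.ne'
    have hl := lat_ne_zero τ hv
    have hy : (τ.im : ℂ) ≠ 0 := by exact_mod_cast τ.im_pos.ne'
    have hyf : (τ.im : ℂ) * latForm τ v = lat τ v * starRingEnd ℂ (lat τ v) := by
      rw [Complex.mul_conj, Complex.normSq_eq_norm_sq, latForm, ← Complex.ofReal_mul,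
        mul_div_cancel₀ _ τ.im_pos.ne']
    rw [latSummand, im_div_sq_norm_lat_cpow, harmCoeff, if_neg hv', latForm_reflect, lat_reflect, hN.neg_pow,
      Complex.cpow_add _ _ hfc, Complex.cpow_natCast, zpow_neg, zpow_natCast]
    have hyf' : (τ.im : ℂ) ^ N * (latForm τ v : ℂ) ^ N =
        lat τ v ^ N * starRingEnd ℂ (lat τ v) ^ N := by rw [← mul_pow, hyf, mul_pow]
    have hfs : (latForm τ v : ℂ) ^ s ≠ 0 := by simp [Complex.cpow_eq_zero_iff, hfc]
    field_simp
    linear_combination hyf'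

/-- The meromorphic continuation of the non-holomorphic lattice Eisenstein series. -/
theorem exists_continuation_latSummand {κ : ℤ} (hκ : Even κ) (τ : ℍ) :
    ∃ G : ℂ → ℂ, (∀ s : ℂ, 2 < 2 * s.re + κ → ∑' v, latSummand κ s τ v = G s) ∧
      (∀ s, MeromorphicAt G s) ∧
      (∀ s, s ≠ 1 ∨ κ ≠ 0 → 0 ≤ meromorphicOrderAt G s) ∧
      (∀ s, ((-1 : ℤ) : WithTop ℤ) ≤ meromorphicOrderAt G s) := by
  obtain ⟨N, rfl | rfl⟩ := κ.eq_nat_or_neg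
  · have hN : Even N := by exact_mod_cast hκ
    obtain ⟨G, h1, h2, h3, h4⟩ := exists_continuation_harmCoeff hN (reflect τ)
    set c : ℂ := ((τ.im : ℂ) ^ N)⁻¹
    have ha : ∀ s : ℂ, AnalyticAt ℂ (fun s : ℂ => s + N) s := fun s => by fun_prop
    have hd : ∀ s : ℂ, deriv (fun s : ℂ => s + N) s ≠ 0 := fun s => by simp
    have hm : ∀ s, MeromorphicAt (G ∘ fun s : ℂ => s + N) s := fun s =>
      (h2 _).comp_analyticAt (ha s)
    have hc : ∀ s, AnalyticAt ℂ (fun _ : ℂ => c) s := fun s => analyticAt_const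
    have hord : ∀ s, meromorphicOrderAt G (s + N) ≤
        meromorphicOrderAt ((fun _ => c) * (G ∘ fun s : ℂ => s + N)) s := fun s => by
      rw [meromorphicOrderAt_mul (hc s).meromorphicAt (hm s),
        meromorphicOrderAt_comp_of_deriv_ne_zero (ha s) (hd s)]
      exact le_add_of_nonneg_left (hc s).meromorphicOrderAt_nonneg
    refine ⟨(fun _ => c) * (G ∘ fun s : ℂ => s + N), fun s hs => ?_,
      fun s => (hc s).meromorphicAt.mul (hm s), fun s hs => ?_, fun s => (h4 _).trans (hord s)⟩
    · simp_rw [latSummand_of_nonneg hN τ hs]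
      rw [tsum_mul_left]
      refine congrArg (c * ·) ?_
      refine (((Equiv.refl ℤ).prodCongr (Equiv.neg ℤ)).tsum_eq (fun v =>
        harmCoeff N (reflect τ) v / (latForm (reflect τ) v : ℂ) ^ (s + N))).trans
        (h1 (s + N) ?_).tsum_eq
      simp at hs ⊢
      linarith
    · refine (h3 _ ?_).trans (hord s)
      -- A pole at w = 1 requires N = 0, and then the shift s+N is trivial.
      by_cases h0 : N = 0
      · subst h0
        simpa using hs
      · exact Or.inr h0
  · have hN : Even N := by
      rw [even_neg] at hκ
      exact_mod_cast hκ
    obtain ⟨G, h1, h2, h3, h4⟩ := exists_continuation_harmCoeff hN τ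
    refine ⟨G, fun s hs => ?_, h2, fun s hs => h3 s (by simpa using hs), h4⟩
    simp_rw [latSummand_of_nonpos N τ hs]
    refine (h1 s ?_).tsum_eq
    push_cast at hs
    linarith

/-! ### Division by ζ -/

theorem meromorphicAt_riemannZeta (z : ℂ) : MeromorphicAt riemannZeta z := by
  by_cases hz : z = 1
  · subst hz
    have h : MeromorphicAt (fun s => (completedRiemannZeta₀ s - 1 / s - 1 / (1 - s)) *
        (Complex.Gammaℝ s)⁻¹) 1 := by
      have h1 := (differentiable_completedZeta₀.analyticAt 1).meromorphicAt
      have h2 := (Complex.differentiable_Gammaℝ_inv.analyticAt 1).meromorphicAt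
      exact ((h1.sub (by fun_prop)).sub (by fun_prop)).mul h2
    refine h.congr ?_
    filter_upwards [mem_nhdsWithin_of_mem_nhds (isOpen_ne.mem_nhds one_ne_zero)] with s hs
    rw [riemannZeta_def_of_ne_zero hs, completedRiemannZeta_eq, ← div_eq_mul_inv]
  · exact (DifferentiableOn.analyticAt (s := {1}ᶜ) differentiableOn_riemannZeta
      (isOpen_compl_singleton.mem_nhds hz)).meromorphicAt

/-- Away from 1 the order of 1/ζ is minus that of ζ. At the pole z = 1, 1/ζ tends to 0 and has
nonnegative order, so the bound holds whatever the value of `analyticOrderNatAt` there. -/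
theorem meromorphicOrderAt_inv_riemannZeta_ge (z : ℂ) :
    ((-(analyticOrderNatAt riemannZeta z : ℤ) : ℤ) : WithTop ℤ) ≤
      meromorphicOrderAt riemannZeta⁻¹ z := by
  by_cases hz : z = 1
  · subst hz
    have h0 : 0 ≤ meromorphicOrderAt riemannZeta⁻¹ 1 := by
      rw [← tendsto_nhds_iff_meromorphicOrderAt_nonneg (meromorphicAt_riemannZeta 1).inv]
      refine ⟨0 * 1⁻¹, ?_⟩
      have h1 := riemannZeta_residue_one.inv₀ one_ne_zero
      have h2 : Filter.Tendsto (fun s : ℂ => s - 1) (nhdsWithin 1 {1}ᶜ) (nhds 0) := by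
        have : Filter.Tendsto (fun s : ℂ => s - 1) (nhds 1) (nhds (1 - 1)) :=
          (continuous_id.sub continuous_const).tendsto 1
        rw [sub_self] at this
        exact this.mono_left nhdsWithin_le_nhds
      refine (h2.mul h1).congr' ?_
      filter_upwards [self_mem_nhdsWithin] with s hs
      have : s - 1 ≠ 0 := sub_ne_zero.mpr hs
      simp only [Pi.inv_apply, mul_inv]
      field_simp
    refine le_trans ?_ h0
    exact_mod_cast neg_nonpos.mpr (Int.natCast_nonneg _)
  · have ha : AnalyticAt ℂ riemannZeta z :=
      DifferentiableOn.analyticAt (s := {1}ᶜ) differentiableOn_riemannZeta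
        (isOpen_compl_singleton.mem_nhds hz)
    rw [meromorphicOrderAt_inv, ha.meromorphicOrderAt_eq, analyticOrderNatAt]
    cases h : analyticOrderAt riemannZeta z with
    -- Identical vanishing need not be excluded: the natural order is then 0 by convention, while
    -- the inverse has order ⊤.
    | top => simp
    | coe n => simp

/-- The meromorphic continuation of the real-analytic Eisenstein series. -/
theorem exists_continuation_eis {κ : ℤ} (hκ : Even κ) (τ : ℍ) :
    ∃ G : ℂ → ℂ, (∀ s : ℂ, 2 < 2 * s.re + κ → G s = eis κ τ s) ∧
      (∀ s, MeromorphicAt G s) ∧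
      (∀ s, analyticOrderNatAt riemannZeta (2 * s + κ) ≤ 1 →
        ((-1 : ℤ) : WithTop ℤ) ≤ meromorphicOrderAt G s) ∧
      (∀ s, 2 ≤ analyticOrderNatAt riemannZeta (2 * s + κ) →
        ((-(analyticOrderNatAt riemannZeta (2 * s + κ) : ℤ) : ℤ) : WithTop ℤ) ≤
          meromorphicOrderAt G s) := by
  obtain ⟨G, h1, h2, h3, h4⟩ := exists_continuation_latSummand hκ τ
  set g : ℂ → ℂ := fun s => 2 * s + κ with hg
  have ha : ∀ s, AnalyticAt ℂ g s := fun s => by fun_prop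
  have hd : ∀ s, deriv g s ≠ 0 := fun s => by
    have : HasDerivAt g (2 * 1) s := ((hasDerivAt_id s).const_mul 2).add_const _
    rw [this.deriv]
    norm_num
  have hc : ∀ s, AnalyticAt ℂ (fun _ : ℂ => (2 : ℂ)⁻¹) s := fun s => analyticAt_const
  have hz : ∀ s, MeromorphicAt (riemannZeta⁻¹ ∘ g) s := fun s =>
    (meromorphicAt_riemannZeta _).inv.comp_analyticAt (ha s)
  have hm := fun s => (hc s).meromorphicAt.mul ((h2 s).mul (hz s))
  have hord : ∀ s, meromorphicOrderAt G s + meromorphicOrderAt riemannZeta⁻¹ (g s) ≤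
      meromorphicOrderAt ((fun _ : ℂ => (2 : ℂ)⁻¹) * (G * (riemannZeta⁻¹ ∘ g))) s := fun s => by
    rw [meromorphicOrderAt_mul (hc s).meromorphicAt ((h2 s).mul (hz s)),
      meromorphicOrderAt_mul (h2 s) (hz s),
      meromorphicOrderAt_comp_of_deriv_ne_zero (ha s) (hd s)]
    exact le_add_of_nonneg_left (hc s).meromorphicOrderAt_nonneg
  -- Here the lattice sum has no pole, so only the zero of ζ contributes.
  have key : ∀ s, s ≠ 1 ∨ κ ≠ 0 →
      ((-(analyticOrderNatAt riemannZeta (g s) : ℤ) : ℤ) : WithTop ℤ) ≤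
        meromorphicOrderAt ((fun _ : ℂ => (2 : ℂ)⁻¹) * (G * (riemannZeta⁻¹ ∘ g))) s :=
    fun s hs => (meromorphicOrderAt_inv_riemannZeta_ge (g s)).trans
      ((le_add_of_nonneg_left (h3 s hs)).trans (hord s))
  -- Here the lattice sum may have a simple pole, but ζ(2) ≠ 0 adds nothing.
  have hone : ∀ s, s = 1 ∧ κ = 0 → ((-1 : ℤ) : WithTop ℤ) ≤
      meromorphicOrderAt ((fun _ : ℂ => (2 : ℂ)⁻¹) * (G * (riemannZeta⁻¹ ∘ g))) s := by
    rintro _ ⟨rfl, rfl⟩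
    have h0 : 0 ≤ meromorphicOrderAt riemannZeta⁻¹ (g 1) := by
      have hg1 : g 1 = 2 := by simp [hg]
      rw [hg1]
      have : AnalyticAt ℂ riemannZeta 2 :=
        DifferentiableOn.analyticAt (s := {1}ᶜ) differentiableOn_riemannZeta
          (isOpen_compl_singleton.mem_nhds (by norm_num))
      exact (this.inv (riemannZeta_ne_zero_of_one_le_re (by norm_num))).meromorphicOrderAt_nonneg
    exact ((h4 1).trans (le_add_of_nonneg_right h0)).trans (hord 1)
  refine ⟨_, fun s hs => ?_, hm, fun s hs => ?_, fun s hs => ?_⟩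
  · have hre : 1 ≤ (2 * s + κ).re := by
      simp
      linarith
    have hζ := riemannZeta_ne_zero_of_one_le_re hre
    have := h1 s hs
    rw [tsum_latSummand hκ τ hs] at this
    simp only [Pi.mul_apply, Function.comp_apply, Pi.inv_apply, hg, ← this]
    field_simp
  · by_cases h : s = 1 ∧ κ = 0
    · exact hone s h
    · refine le_trans ?_ (key s (by tauto))
      exact WithTop.coe_le_coe.mpr (by simp only [hg]; omega)
  · by_cases h : s = 1 ∧ κ = 0
    · refine le_trans ?_ (hone s h)
      exact WithTop.coe_le_coe.mpr (by omega)
    · exact key s (by tauto)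

end VecEis

end

/-! ### The vector-valued series -/

theorem mainTheorem7 (k : ℤ) (m j : ℕ) (hj : j ≤ m) (hkm : k ≡ (m : ℤ) [ZMOD 2]) :
    (∀ (τ : ℍ) (s : ℂ), 2 + (m : ℝ) < 2 * s.re + (k : ℝ) →
      (∀ n : ℕ, Summable fun q : VecEis.Cosets => (VecEis.eisAholTerm k m j s τ q).coeff n) ∧
      (Summable fun q : VecEis.Cosets => VecEis.eisTerm (k - m + 2 * j) s τ q) ∧
      VecEis.eisAhol k m j τ s =
        VecEis.basisE m j τ * C (VecEis.eis (k - m + 2 * j) τ s)) ∧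
    (∃ F : ℍ → ℂ → ℂ[X], ∀ τ : ℍ,
      (∀ s : ℂ, 2 + (m : ℝ) < 2 * s.re + (k : ℝ) → F τ s = VecEis.eisAhol k m j τ s) ∧
      (∀ s : ℂ, (F τ s).natDegree ≤ m) ∧
      (∀ n : ℕ, Meromorphic fun s : ℂ => (F τ s).coeff n) ∧
      (∀ (n : ℕ) (s₀ : ℂ), analyticOrderNatAt riemannZeta (2 * s₀ + (k - m + 2 * j)) ≤ 1 →
        ((-1 : ℤ) : WithTop ℤ) ≤ meromorphicOrderAt (fun s : ℂ => (F τ s).coeff n) s₀) ∧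
      (∀ (n : ℕ) (s₀ : ℂ), 2 ≤ analyticOrderNatAt riemannZeta (2 * s₀ + (k - m + 2 * j)) →
        ((-(analyticOrderNatAt riemannZeta (2 * s₀ + (k - m + 2 * j)) : ℤ) : ℤ) : WithTop ℤ) ≤
          meromorphicOrderAt (fun s : ℂ => (F τ s).coeff n) s₀)) := by
  have hκ : Even (k - m + 2 * j) := by
    obtain ⟨c, hc⟩ := hkm.dvd
    exact ⟨j - c, by omega⟩
  -- As j ≥ 0, κ ≥ k-m, so the stated half-plane lies in the region of convergence of E_κ.
  have hre : ∀ s : ℂ, 2 + (m : ℝ) < 2 * s.re + (k : ℝ) →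
      2 < 2 * s.re + ((k - m + 2 * j : ℤ) : ℝ) := fun s hs => by
    push_cast
    have : (0 : ℝ) ≤ j := j.cast_nonneg
    linarith
  refine ⟨fun τ s hs => ⟨fun n => ?_, VecEis.summable_eisTerm τ (hre s hs),
    VecEis.eisAhol_eq k m j hj s τ⟩, ?_⟩
  · simp_rw [VecEis.eisAholTerm_eq k m j hj, coeff_mul_C]
    exact (VecEis.summable_eisTerm τ (hre s hs)).mul_left _
  · choose G h1 h2 h3 h4 using fun τ : ℍ => VecEis.exists_continuation_eis hκ τ
    have hc : ∀ (τ : ℍ) (n : ℕ) (s : ℂ),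
        AnalyticAt ℂ (fun _ : ℂ => (VecEis.basisE m j τ).coeff n) s :=
      fun τ n s => analyticAt_const
    have hF : ∀ (τ : ℍ) (n : ℕ), (fun s : ℂ => (VecEis.basisE m j τ * C (G τ s)).coeff n) =
        (fun _ : ℂ => (VecEis.basisE m j τ).coeff n) * G τ := fun τ n => by
      funext s
      rw [coeff_mul_C, Pi.mul_apply]
    -- The coefficients of 𝔢 do not depend on s, so multiplying by them cannot lower the order.
    have hord : ∀ (τ : ℍ) (n : ℕ) (s : ℂ), meromorphicOrderAt (G τ) s ≤
        meromorphicOrderAt (fun s : ℂ => (VecEis.basisE m j τ * C (G τ s)).coeff n) s :=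
      fun τ n s => by
        rw [hF, meromorphicOrderAt_mul (hc τ n s).meromorphicAt (h2 τ s)]
        exact le_add_of_nonneg_left (hc τ n s).meromorphicOrderAt_nonneg
    refine ⟨fun τ s => VecEis.basisE m j τ * C (G τ s), fun τ => ⟨fun s hs => ?_, fun s => ?_,
      fun n s => ?_, fun n s hs => ?_, fun n s hs => ?_⟩⟩
    · change VecEis.basisE m j τ * C (G τ s) = _
      rw [h1 τ s (hre s hs), VecEis.eisAhol_eq k m j hj s τ]
    · exact (natDegree_mul_C_le _ _).trans (VecEis.natDegree_basisE m j hj τ)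
    · rw [hF]
      exact (hc τ n s).meromorphicAt.mul (h2 τ s)
    · exact (h3 τ s (by push_cast; exact hs)).trans (hord τ n s)
    · have := h4 τ s (by push_cast; exact hs)
      push_cast at this ⊢
      exact this.trans (hord τ n s)
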